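/- Let $M$ be a lattice of rank $d$ and let $\Lambda \subset M$ be a finitely generated subsemigroup containing $0$ which generates $M$ as a group and such that the cone $\mathbf R_{\ge 0}\Lambda \subset M_{\mathbf R} = M \otimes_{\mathbf Z} \mathbf R$ is strictly convex. Let $\sigma \subset N_{\mathbf R}$ be the dual cone of $\mathbf R_{\ge 0}\Lambda$, where $N$ is the dual lattice of $M$, and let $Z^\Lambda = \operatorname{Spec} \mathbf C[\Lambda]$ be the associated affine toric variety, whose origin $0$ is the point defined by the maximal ideal generated by the monomials $X^u$, $0 \ne u \in \Lambda$. For a face $\theta$ of $\sigma$, let $H_{\Lambda\cap\theta^\perp}$ be the set of arcs $\operatorname{Spec}\mathbf C[[t]] \to Z^\Lambda$ with origin at $0$ which factor through the orbit closure $Z^{\Lambda \cap \theta^\perp} \subset Z^\Lambda$, and let $H^*_\Lambda$ be the set of arcs of $Z^\Lambda$ with origin at $0$ and with generic point in the torus $\operatorname{Spec} \mathbf C[M]$. For $s \ge 0$ let $j_s$ be the map which sends an arc to its $s$-jet in the $s$-jet space $H_s(Z^\Lambda)$. The auxiliary Poincaré series is $$P(\Lambda) := \sum_{s \ge 0} \Big[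 j_s(H^*_\Lambda) \setminus \bigcup_{0 \ne \theta \le \sigma} j_s(H_{\Lambda\cap\theta^\perp}) \Big] T^s \in K_0(\mathrm{Var}_{\mathbf C})[[T]],$$ where $[C]$ denotes the class of a constructible set $C$ in the Grothendieck ring of complex varieties. Put $\mathbf L := [\mathbf A^1_{\mathbf C}]$. Suppose that $d = 1$, so that $Z^\Lambda$ is a monomial curve, and let $m$ be the (Hilbert–Samuel) multiplicity of $Z^\Lambda$ at the origin. Then the sets of jets appearing in the definition of $P(\Lambda)$ are constructible, and $$P(\Lambda) = (\mathbf L - 1)\, T^m\, (1 - \mathbf L T)^{-1} (1 - T^m)^{-1} \quad \text{in } K_0(\mathrm{Var}_{\mathbf C})[[T]].$$ -/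

import Mathlib

open CategoryTheory AlgebraicGeometry
open scoped Polynomial PowerSeries Nat

noncomputable section

namespace MotivicToric

/-! ### Complex varieties -/

/-- The base scheme `Spec ℂ`. -/
abbrev SpecC : Scheme.{0} := Spec (CommRingCat.of ℂ)

/-- A complex variety: a reduced separated scheme of finite type over `ℂ`
(not necessarily irreducible, possibly empty). -/
structure CVariety where
  toOver : Over SpecC
  reduced : IsReduced toOver.left
  separated : IsSeparated toOver.hom
  locallyOfFiniteType : LocallyOfFiniteType toOver.hom
  quasiCompact : QuasiCompact toOver.hom

/-- The affine scheme of a `ℂ`-algebra, as a scheme over `ℂ`. -/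
def specOver (A : Type) [CommRing A] [Algebra ℂ A] : Over SpecC :=
  Over.mk (Spec.map (CommRingCat.ofHom (algebraMap ℂ A)))

/-- The affine variety of a reduced `ℂ`-algebra of finite type. -/
def CVariety.ofAlgebra (A : Type) [CommRing A] [Algebra ℂ A] [_root_.IsReduced A]
    [Algebra.FiniteType ℂ A] : CVariety where
  toOver := specOver A
  reduced := inferInstanceAs (IsReduced (Spec (CommRingCat.of A)))
  separated := inferInstanceAs
    (IsSeparated (Spec.map (CommRingCat.ofHom (algebraMap ℂ A))))
  locallyOfFiniteType := by
    refine (HasRingHomProperty.Spec_iff (P := @LocallyOfFiniteType)).mpr ?_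
    exact RingHom.finiteType_algebraMap.mpr inferInstance
  quasiCompact := inferInstanceAs
    (QuasiCompact (Spec.map (CommRingCat.ofHom (algebraMap ℂ A))))

/-! ### The Grothendieck ring of complex varieties -/

/-- The relations of the Grothendieck ring of varieties, in the free commutative ring on the
symbols of all complex varieties. -/
inductive K0Rel : FreeCommRing CVariety → FreeCommRing CVariety → Prop
  /-- `[X] = [Y]` if `X` and `Y` are isomorphic over `ℂ`. -/
  | iso (X Y : CVariety) (e : X.toOver ≅ Y.toOver) :
      K0Rel (FreeCommRing.of X) (FreeCommRing.of Y)
  /-- `[X] = [X ∖ Z] + [Z]` if `Z` is a closed subvariety of `X`. -/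
  | scissor (X Z U : CVariety) (i : Z.toOver ⟶ X.toOver) (j : U.toOver ⟶ X.toOver)
      (hi : IsClosedImmersion i.left) (hj : IsOpenImmersion j.left)
      (hij : Set.range j.left = (Set.range i.left)ᶜ) :
      K0Rel (FreeCommRing.of X) (FreeCommRing.of U + FreeCommRing.of Z)
  /-- `[X][Y] = [X × Y]`. -/
  | prod (X Y P : CVariety) (p : P.toOver ⟶ X.toOver) (q : P.toOver ⟶ Y.toOver)
      (hpq : IsPullback p.left q.left X.toOver.hom Y.toOver.hom) :
      K0Rel (FreeCommRing.of X * FreeCommRing.of Y) (FreeCommRing.of P)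
  /-- The class of a point is the unit of the ring. -/
  | point : K0Rel (FreeCommRing.of (CVariety.ofAlgebra ℂ)) 1

/-- The Grothendieck ring `K₀(Var_ℂ)` of complex varieties. -/
abbrev K0Var : Type 1 := RingQuot K0Rel

/-- The class `[X]` of a variety. -/
def varClass (X : CVariety) : K0Var := RingQuot.mkRingHom K0Rel (FreeCommRing.of X)

/-- The class `𝐋` of the affine line. -/
def lefschetz : K0Var := varClass (CVariety.ofAlgebra ℂ[X])

/-! ### Classes of constructible sets -/

/-- The set `X(ℂ)` of `ℂ`-rational points of a `ℂ`-scheme. -/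
abbrev CPoints (X : Over SpecC) : Type := Over.mk (𝟙 SpecC) ⟶ X

/-- The family `f` of immersions of varieties exhibits the set `C` of `ℂ`-points of `X` as the
disjoint union of finitely many locally closed subvarieties of `X`. -/
structure IsPartition {X : Over SpecC} (C : Set (CPoints X)) {k : ℕ} (A : Fin k → CVariety)
    (f : ∀ i, (A i).toOver ⟶ X) : Prop where
  immersion : ∀ i, IsImmersion (f i).left
  disjoint : Pairwise fun i j =>
    Disjoint (Set.range fun p : CPoints (A i).toOver => p ≫ f i)
      (Set.range fun p : CPoints (A j).toOver => p ≫ f j)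
  iUnion_eq : ⋃ i, (Set.range fun p : CPoints (A i).toOver => p ≫ f i) = C

/-- `C` is a finite disjoint union of locally closed subvarieties `Aᵢ` with `x = ∑ [Aᵢ]`. -/
def HasClass {X : Over SpecC} (C : Set (CPoints X)) (x : K0Var) : Prop :=
  ∃ (k : ℕ) (A : Fin k → CVariety) (f : ∀ i, (A i).toOver ⟶ X),
    IsPartition C A f ∧ x = ∑ i, varClass (A i)

/-- `C` is a constructible set of `ℂ`-points. -/
def IsConstructibleSet {X : Over SpecC} (C : Set (CPoints X)) : Prop := ∃ x, HasClass C x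

open Classical in
/-- The class `[C]` in the Grothendieck ring of a constructible set `C`, namely `∑ [Aᵢ]` for a
partition of `C` into finitely many locally closed subvarieties `Aᵢ`
(and `0` if `C` is not constructible). -/
def constructibleClass {X : Over SpecC} (C : Set (CPoints X)) : K0Var :=
  if h : IsConstructibleSet C then h.choose else 0

/-! ### Arcs and jets on an affine `ℂ`-scheme -/

section Jets

variable (R : Type) [CommRing R] [Algebra ℂ R]

/-- An arc `Spec ℂ[[t]] → Spec R`, given by its comorphism. -/
abbrev Arc : Type := R →ₐ[ℂ] ℂ⟦X⟧

variable {R} in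
/-- The universal truncated expansion `∑_{j ≤ s} f^{(j)} t^j` of a function `f`, where the
`f^{(j)}` are indeterminates. -/
def universalJet (s : ℕ) (f : R) : Polynomial (MvPolynomial (R × Fin (s + 1)) ℂ) :=
  ∑ j : Fin (s + 1), Polynomial.monomial (j : ℕ) (MvPolynomial.X (f, j))

/-- The relations between the indeterminates `f^{(j)}` which say that
`f ↦ ∑_{j ≤ s} f^{(j)} t^j mod t^{s+1}` is a homomorphism of `ℂ`-algebras. -/
def jetRelations (s : ℕ) : Set (MvPolynomial (R × Fin (s + 1)) ℂ) :=
  {x | ∃ k ≤ s,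
    (∃ f g : R, x = (universalJet s (f + g) - (universalJet s f + universalJet s g)).coeff k) ∨
    (∃ f g : R, x = (universalJet s (f * g) - universalJet s f * universalJet s g).coeff k) ∨
    (∃ c : ℂ, x = (universalJet s (algebraMap ℂ R c) -
      Polynomial.C (MvPolynomial.C c)).coeff k)}

/-- The coordinate ring of the reduced `s`-jet scheme of `Spec R`. Before reduction it represents
the functor sending a `ℂ`-algebra `B` to the set of `B[t]/(t^{s+1})`-rational points of `Spec R`. -/
abbrev JetRing (s : ℕ) : Type :=
  MvPolynomial (R × Fin (s + 1)) ℂ ⧸ (Ideal.span (jetRelations R s)).radical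

/-- The `s`-jet space `H_s(Spec R)`, with its reduced structure. -/
abbrev jetSpace (s : ℕ) : Over SpecC := specOver (JetRing R s)

variable {R}

lemma jetRelations_le_ker (s : ℕ) (h : Arc R) :
    (Ideal.span (jetRelations R s)).radical ≤
      RingHom.ker (MvPolynomial.aeval (R := ℂ)
        (fun p : R × Fin (s + 1) => PowerSeries.coeff (p.2 : ℕ) (h p.1))) := by
  set ev : MvPolynomial (R × Fin (s + 1)) ℂ →ₐ[ℂ] ℂ := MvPolynomial.aeval (R := ℂ)
    (fun p : R × Fin (s + 1) => PowerSeries.coeff (p.2 : ℕ) (h p.1)) with hev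
  have key : ∀ (f : R) (k : ℕ), k ≤ s →
      ev ((universalJet s f).coeff k) = PowerSeries.coeff k (h f) := by
    intro f k hk
    have : (universalJet s f).coeff k =
        MvPolynomial.X (f, (⟨k, Nat.lt_succ_of_le hk⟩ : Fin (s + 1))) := by
      rw [universalJet, Polynomial.finsetSum_coeff,
        Finset.sum_eq_single (⟨k, Nat.lt_succ_of_le hk⟩ : Fin (s + 1))]
      · simp
      · intro b _ hb
        rw [Polynomial.coeff_monomial, if_neg]
        intro hbk
        exact hb (Fin.ext hbk)
      · simp
    rw [this, hev, MvPolynomial.aeval_X]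
  refine (Ideal.IsRadical.radical_le_iff ?_).mpr (Ideal.span_le.mpr ?_)
  · exact (RingHom.ker_isPrime ev.toRingHom).isRadical
  rintro x ⟨k, hk, ⟨f, g, rfl⟩ | ⟨f, g, rfl⟩ | ⟨c, rfl⟩⟩
  · change ev _ = 0
    simp [key _ k hk]
  · change ev _ = 0
    rw [Polynomial.coeff_sub, map_sub, key _ k hk, Polynomial.coeff_mul, map_mul,
      PowerSeries.coeff_mul, map_sum, sub_eq_zero]
    refine Finset.sum_congr rfl fun p hp => ?_
    have hp' := Finset.HasAntidiagonal.mem_antidiagonal.mp hp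
    rw [map_mul, key _ _ (by omega), key _ _ (by omega)]
  · change ev _ = 0
    rw [Polynomial.coeff_sub, map_sub, key _ k hk, AlgHom.commutes, Polynomial.coeff_C,
      PowerSeries.algebraMap_apply, PowerSeries.coeff_C]
    split_ifs <;> simp

/-- The coordinate expression of the jet `j_s(h)`: the value of `f^{(j)}` at `j_s(h)` is the
coefficient of `t^j` in `f ∘ h`. -/
def jetHom (s : ℕ) (h : Arc R) : JetRing R s →ₐ[ℂ] ℂ :=
  Ideal.Quotient.liftₐ _
    (MvPolynomial.aeval fun p : R × Fin (s + 1) => PowerSeries.coeff (p.2 : ℕ) (h p.1))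
    fun _ ha => jetRelations_le_ker s h ha

/-- The `s`-jet `j_s(h)` of an arc `h`, a `ℂ`-point of the `s`-jet space. -/
def jet (s : ℕ) (h : Arc R) : CPoints (jetSpace R s) :=
  Over.homMk (Spec.map (CommRingCat.ofHom (jetHom s h).toRingHom)) (by
    change Spec.map _ ≫ Spec.map _ = 𝟙 _
    rw [← Spec.map_comp, ← CommRingCat.ofHom_comp]
    have : (jetHom s h).toRingHom.comp (algebraMap ℂ (JetRing R s)) = RingHom.id ℂ :=
      (jetHom s h).comp_algebraMap
    rw [this, CommRingCat.ofHom_id, Spec.map_id])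

end Jets

/-! ### Affine toric varieties -/

section Toric

open scoped TensorProduct

variable {M : Type} [AddCommGroup M] (Λ : AddSubmonoid M)

/-- The cone `σ^∨ = ℝ_{≥ 0} Λ` in `M_ℝ = ℝ ⊗ M`. -/
def realCone : PointedCone ℝ (ℝ ⊗[ℤ] M) :=
  PointedCone.hull ℝ ((fun m : M => (1 : ℝ) ⊗ₜ[ℤ] m) '' Λ)

/-- The dual cone `σ` of `ℝ_{≥ 0} Λ` in `N_ℝ`, the dual vector space of `M_ℝ`. -/
def dualCone : PointedCone ℝ (Module.Dual ℝ (ℝ ⊗[ℤ] M)) :=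
  PointedCone.dual (Module.Dual.eval ℝ (ℝ ⊗[ℤ] M)) (realCone Λ : Set (ℝ ⊗[ℤ] M))

/-- The coordinate ring `ℂ[Λ]` of the affine toric variety `Z^Λ = Spec ℂ[Λ]`. -/
abbrev CoordRing : Type := AddMonoidAlgebra ℂ Λ

/-- The monomial `X^u`, for `u ∈ Λ`. -/
abbrev monom {Λ : AddSubmonoid M} (u : Λ) : CoordRing Λ := AddMonoidAlgebra.single u 1

/-- The ideal `(X^u)_{0 ≠ u ∈ Λ}` of the origin `0` of `Z^Λ`. -/
def originIdeal : Ideal (CoordRing Λ) :=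
  Ideal.span {x | ∃ u : Λ, u ≠ 0 ∧ x = monom u}

/-- The torus `T_N = Spec ℂ[M]` as a set of points of `Z^Λ`. -/
def torus : Set (PrimeSpectrum (CoordRing Λ)) :=
  Set.range (PrimeSpectrum.comap (AddMonoidAlgebra.mapDomainRingHom ℂ Λ.subtype :
    CoordRing Λ →+* AddMonoidAlgebra ℂ M))

/-- `H_Λ`: the arcs of `Z^Λ` with origin at `0`, i.e. mapping the closed point of `Spec ℂ[[t]]`
to the origin. -/
def arcsAtOrigin : Set (Arc (CoordRing Λ)) :=
  {h | Ideal.comap h.toRingHom (IsLocalRing.maximalIdeal ℂ⟦X⟧) = originIdeal Λ}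

/-- `H_Λ^*`: the arcs in `H_Λ` mapping the generic point of `Spec ℂ[[t]]` into the torus. -/
def torusArcs : Set (Arc (CoordRing Λ)) :=
  {h ∈ arcsAtOrigin Λ | PrimeSpectrum.comap h.toRingHom ⊥ ∈ torus Λ}

/-- `H_{Λ ∩ θ^⊥}`: the arcs in `H_Λ` factoring through the orbit closure
`Z^{Λ ∩ θ^⊥} ⊆ Z^Λ`, the closed subvariety defined by the vanishing of the monomials `X^u`
for `u ∈ Λ ∖ θ^⊥`. -/
def faceArcs (θ : PointedCone ℝ (Module.Dual ℝ (ℝ ⊗[ℤ] M))) : Set (Arc (CoordRing Λ)) :=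
  {h ∈ arcsAtOrigin Λ | ∀ u : Λ, ¬ (∀ ν ∈ θ, ν ((1 : ℝ) ⊗ₜ[ℤ] (u : M)) = 0) → h (monom u) = 0}

/-- The set `j_s(H_Λ^*) ∖ ⋃_{0 ≠ θ ≤ σ} j_s(H_{Λ ∩ θ^⊥})` of `s`-jets. -/
def auxiliaryJets (s : ℕ) : Set (CPoints (jetSpace (CoordRing Λ) s)) :=
  (jet s '' torusArcs Λ) \
    ⋃ θ ∈ {θ | PointedCone.IsFaceOf θ (dualCone Λ) ∧ θ ≠ ⊥}, jet s '' faceArcs Λ θ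

/-- The auxiliary Poincaré series
`P(Λ) = ∑_s [j_s(H_Λ^*) ∖ ⋃_{0 ≠ θ ≤ σ} j_s(H_{Λ ∩ θ^⊥})] T^s`. -/
def auxiliarySeries : K0Var⟦X⟧ :=
  PowerSeries.mk fun s => constructibleClass (auxiliaryJets Λ s)

end Toric

/-! ### Multiplicity -/

/-- `m` is the Hilbert–Samuel multiplicity of `Spec R` at the closed point given by the maximal
ideal `I` : the length of `R/Iⁿ` (equivalently, of `R_I/(I R_I)ⁿ`) agrees for `n ≫ 0` with a
polynomial `p(n)` of some degree `d`, and `m` is `d!` times the leading coefficient of `p`. -/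
def HasMultiplicity {R : Type*} [CommRing R] (I : Ideal R) (m : ℕ) : Prop :=
  ∃ p : ℚ[X],
    (∀ᶠ n : ℕ in Filter.atTop, ∃ l : ℕ,
      Module.length R (R ⧸ I ^ n) = l ∧ (l : ℚ) = p.eval (n : ℚ)) ∧
    (m : ℚ) = (p.natDegree)! * p.leadingCoeff

end MotivicToric

end

/-! In rank one, strict convexity lets a coordinate on $M$ identify $\Lambda$ with a semigroup of
natural numbers (`exists_coord`, `weight`). It contains all large integers, because $\Lambda$
generates $M$. An arc with origin at $0$ and generic point in the torus lifts to the normalization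
$\mathbf A^1$: it is $X^u \mapsto f^u$ for a nonzero series $f$ without constant term
(`exists_eq_monomialArc`). Every nonzero face of $\sigma$ contributes only the constant arc at the
origin, because a nonzero linear form on a line kills no nonzero $u$ (`iUnion_jet_faceArcs`).

Let $m$ be the least positive element of $\Lambda$ and $n = \operatorname{ord} f$. The $s$-jet
differs from that of the constant arc exactly when $nm \le s$, and it then determines $n$. So the
set of jets is a disjoint union over $1 \le n \le s/m$. The heart of the proof is `exists_stratum`,
which shows that each piece is a locally closed copy of $\mathbf G_m \times \mathbf A^{s-nm}$. Write
$f = c\,t^n(1 + a_1t + \cdots)$. The coefficients of $f^m$ determine $a_1, \dots, a_{s-nm}$, and the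
later $a_i$ are invisible in the jet. The leading coefficient $c$ is seen only through the powers
$c^u$ with $nu \le s$, that is, through $c^g$ with $g$ the gcd of those $u$; the coordinate on
$\mathbf G_m$ is therefore $c^g$.

Hence the coefficient of $T^s$ is $\sum_n (\mathbf L-1)\mathbf L^{s-nm}$, and `mk_sum_Icc_eq` sums
the series. That $m$ is the multiplicity follows by bounding the length of the quotient by the
$n$-th power of the origin ideal within a constant of $nm$ (`HasMultiplicity.eq_of_monomialIdeal`).

Since the class of a constructible set is defined by a chosen partition, its independence of the
choice has to be proved as well (`HasClass.unique`). -/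

noncomputable section

namespace MotivicToric

/-! ### Reduced locally closed subschemes -/

/-- A morphism from a reduced scheme factors through an immersion containing its image. -/
lemma exists_lift_of_range_subset {A V T : Scheme.{0}} (f : A ⟶ V) [IsImmersion f] (g : T ⟶ V)
    [IsReduced T] (h : Set.range g ⊆ Set.range f) : ∃ l : T ⟶ A, l ≫ f = g := by
  have hr : Set.range (Limits.pullback.snd f g) = Set.univ := by
    rw [Scheme.Pullback.range_snd, Set.preimage_eq_univ_iff]
    exact h
  have : Surjective (Limits.pullback.snd f g) := ⟨Set.range_eq_univ.mp hr⟩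
  -- The base change of `f` along `g` is a surjective immersion, so its range is closed; a
  -- surjective closed immersion into a reduced scheme is an isomorphism, and its inverse provides
  -- the lift.
  have : IsClosedImmersion (Limits.pullback.snd f g) :=
    IsClosedImmersion.of_isPreimmersion _ (by rw [hr]; exact isClosed_univ)
  have := isIso_of_isClosedImmersion_of_surjective (Limits.pullback.snd f g)
  exact ⟨inv (Limits.pullback.snd f g) ≫ Limits.pullback.fst f g, by
    rw [Category.assoc, Limits.pullback.condition, IsIso.inv_hom_id_assoc]⟩

lemma isReduced_vanishingIdeal_subscheme {X : Scheme.{0}} (Z : TopologicalSpace.Closeds X) :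
    IsReduced (Scheme.IdealSheafData.vanishingIdeal Z).subscheme := by
  set I := Scheme.IdealSheafData.vanishingIdeal Z with hI
  have : ∀ i, IsReduced (I.subschemeCover.openCover.X i) := by
    intro i
    let U : X.affineOpens := i
    have : _root_.IsReduced (Γ(X, U.1) ⧸ I.ideal U) := by
      rw [← Ideal.isRadical_iff_quotient_reduced, hI, Scheme.IdealSheafData.vanishingIdeal_ideal]
      exact PrimeSpectrum.isRadical_vanishingIdeal _
    exact inferInstanceAs (IsReduced (Spec (CommRingCat.of (Γ(X, U.1) ⧸ I.ideal U))))
  exact IsReduced.of_openCover _ I.subschemeCover.openCover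

instance (V : CVariety) : IsReduced V.toOver.left := V.reduced
instance (V : CVariety) : IsSeparated V.toOver.hom := V.separated
instance (V : CVariety) : LocallyOfFiniteType V.toOver.hom := V.locallyOfFiniteType
instance (V : CVariety) : QuasiCompact V.toOver.hom := V.quasiCompact

instance (V : CVariety) : IsNoetherian V.toOver.left := by
  have : IsLocallyNoetherian V.toOver.left := LocallyOfFiniteType.isLocallyNoetherian V.toOver.hom
  have : CompactSpace V.toOver.left := by
    exact (quasiCompact_iff_compactSpace V.toOver.hom).mp inferInstance
  exact {}

instance (V : CVariety) : JacobsonSpace V.toOver.left :=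
  LocallyOfFiniteType.jacobsonSpace V.toOver.hom

/-- A reduced scheme immersed in a variety is a variety. -/
def CVariety.ofImmersion (V : CVariety) {D : Scheme.{0}} [IsReduced D] (f : D ⟶ V.toOver.left)
    [IsImmersion f] : CVariety where
  toOver := Over.mk (f ≫ V.toOver.hom)
  reduced := ‹_›
  separated := inferInstanceAs (IsSeparated (f ≫ V.toOver.hom))
  locallyOfFiniteType := inferInstanceAs (LocallyOfFiniteType (f ≫ V.toOver.hom))
  quasiCompact := by
    have : TopologicalSpace.NoetherianSpace D :=
      f.isEmbedding.isInducing.noetherianSpace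
    exact inferInstanceAs (QuasiCompact (f ≫ V.toOver.hom))

/-- The immersion of `V.ofImmersion f` in `V`, as a morphism over `ℂ`. -/
def CVariety.ofImmersionHom (V : CVariety) {D : Scheme.{0}} [IsReduced D] (f : D ⟶ V.toOver.left)
    [IsImmersion f] : (V.ofImmersion f).toOver ⟶ V.toOver := Over.homMk f rfl

lemma CVariety.exists_closed (V : CVariety) {S : Set V.toOver.left} (hS : IsClosed S) :
    ∃ (D : CVariety) (f : D.toOver ⟶ V.toOver),
      IsClosedImmersion f.left ∧ Set.range f.left = S := by
  have := isReduced_vanishingIdeal_subscheme (⟨S, hS⟩ : TopologicalSpace.Closeds V.toOver.left)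
  refine ⟨V.ofImmersion (Scheme.IdealSheafData.vanishingIdeal ⟨S, hS⟩).subschemeι,
    V.ofImmersionHom _, ?_, ?_⟩
  · exact inferInstanceAs (IsClosedImmersion
      (Scheme.IdealSheafData.vanishingIdeal (⟨S, hS⟩ : TopologicalSpace.Closeds _)).subschemeι)
  · exact (Scheme.IdealSheafData.range_subschemeι _).trans
      (Scheme.IdealSheafData.coe_support_vanishingIdeal _)

lemma CVariety.exists_open (V : CVariety) {S : Set V.toOver.left} (hS : IsOpen S) :
    ∃ (D : CVariety) (f : D.toOver ⟶ V.toOver), IsOpenImmersion f.left ∧ Set.range f.left = S := by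
  let U : V.toOver.left.Opens := ⟨S, hS⟩
  refine ⟨V.ofImmersion U.ι, V.ofImmersionHom U.ι, ?_, ?_⟩
  · exact inferInstanceAs (IsOpenImmersion U.ι)
  · exact Scheme.Opens.range_ι U

lemma CVariety.exists_locallyClosed (V : CVariety) {S : Set V.toOver.left}
    (hS : IsLocallyClosed S) :
    ∃ (D : CVariety) (f : D.toOver ⟶ V.toOver), IsImmersion f.left ∧ Set.range f.left = S := by
  obtain ⟨U, Z, hU, hZ, rfl⟩ := hS
  obtain ⟨D, f, hf, hfr⟩ := V.exists_open hU
  obtain ⟨E, g, hg, hgr⟩ := D.exists_closed (hZ.preimage f.left.continuous)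
  refine ⟨E, g ≫ f, ?_, ?_⟩
  · rw [Over.comp_left]; infer_instance
  · rw [Over.comp_left, Scheme.Hom.comp_base, TopCat.coe_comp, Set.range_comp, hgr,
      Set.image_preimage_eq_range_inter, hfr]

/-- A `ℂ`-morphism from a reduced scheme factors through an immersion containing its image. -/
lemma exists_over_lift {A V T : Over SpecC} (f : A ⟶ V) [IsImmersion f.left] (g : T ⟶ V)
    [IsReduced T.left] (h : Set.range g.left ⊆ Set.range f.left) : ∃ l : T ⟶ A, l ≫ f = g := by
  obtain ⟨l, hl⟩ := exists_lift_of_range_subset f.left g.left h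
  refine ⟨Over.homMk l ?_, ?_⟩
  · rw [← Over.w f, reassoc_of% hl, Over.w g]
  · ext : 1
    exact hl

lemma varClass_eq_of_iso {X Y : CVariety} (e : X.toOver ≅ Y.toOver) : varClass X = varClass Y :=
  RingQuot.mkRingHom_rel (K0Rel.iso X Y e)

/-- Reducedness makes each immersion factor through the other, and the factorizations are mutually
inverse because immersions are monomorphisms. Thus the class of a reduced locally closed subscheme
depends only on its underlying set. -/
lemma varClass_eq_of_range_eq {V : Over SpecC} {A B : CVariety} (f : A.toOver ⟶ V)
    (g : B.toOver ⟶ V) [IsImmersion f.left] [IsImmersion g.left]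
    (h : Set.range f.left = Set.range g.left) : varClass A = varClass B := by
  obtain ⟨l, hl⟩ := exists_over_lift g f h.le
  obtain ⟨l', hl'⟩ := exists_over_lift f g h.ge
  have hf : Mono f := (Over.forget SpecC).mono_of_mono_map (inferInstanceAs (Mono f.left))
  have hg : Mono g := (Over.forget SpecC).mono_of_mono_map (inferInstanceAs (Mono g.left))
  exact varClass_eq_of_iso ⟨l, l', by rw [← cancel_mono f]; simp [hl, hl'],
    by rw [← cancel_mono g]; simp [hl, hl']⟩

lemma varClass_scissor {X Z U : CVariety} (i : Z.toOver ⟶ X.toOver) (j : U.toOver ⟶ X.toOver)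
    (hi : IsClosedImmersion i.left) (hj : IsOpenImmersion j.left)
    (hij : Set.range j.left = (Set.range i.left)ᶜ) : varClass X = varClass U + varClass Z := by
  have := RingQuot.mkRingHom_rel (K0Rel.scissor X Z U i j hi hj hij)
  rw [map_add] at this
  exact this

/-- The scissor relation with all three varieties equal to `X` reads $[X] = [X] + [X]$. -/
lemma varClass_eq_zero_of_isEmpty (X : CVariety) [IsEmpty X.toOver.left] : varClass X = 0 := by
  have := varClass_scissor (𝟙 X.toOver) (𝟙 X.toOver)
    (by rw [Over.id_left]; infer_instance) (by rw [Over.id_left]; infer_instance)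
    (Set.eq_of_subset_of_subset (fun x => isEmptyElim x) (fun x => isEmptyElim x))
  simpa using this

/-! ### Finite families of locally closed sets -/

/-- Induction on the family, with a member written $U \cap C$. If $O \cap Z$ leaves $C$, shrink $O$
to avoid this member. Otherwise $O \cap Z \subseteq C$, and either $O \cap U \cap Z$ is nonempty and
inside the member, or the member was not needed for the covering. -/
lemma exists_isOpen_inter_subset_of_subset_iUnion {X ι : Type*} [TopologicalSpace X]
    {S : ι → Set X} (hS : ∀ i, IsLocallyClosed (S i)) (Z : Set X) (s : Finset ι) :
    ∀ O : Set X, IsOpen O → (O ∩ Z).Nonempty → O ∩ Z ⊆ ⋃ i ∈ s, S i →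
      ∃ i, ∃ U : Set X, IsOpen U ∧ (U ∩ Z).Nonempty ∧ U ∩ Z ⊆ S i := by
  classical
  induction s using Finset.induction_on with
  | empty =>
    intro O _ ⟨x, hx⟩ h
    simpa using h hx
  | insert a s _ ih =>
    intro O hO hne h
    obtain ⟨U, C, hU, hC, hSa⟩ := hS a
    rw [Finset.set_biUnion_insert] at h
    by_cases h1 : (O ∩ Cᶜ ∩ Z).Nonempty
    · refine ih (O ∩ Cᶜ) (hO.inter hC.isOpen_compl) h1 fun x hx => ?_
      refine (h ⟨hx.1.1, hx.2⟩).resolve_left fun hxa => hx.1.2 ?_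
      rw [hSa] at hxa
      exact hxa.2
    · have hOC : O ∩ Z ⊆ C := fun x hx => by
        by_contra hxC
        exact h1 ⟨x, ⟨hx.1, hxC⟩, hx.2⟩
      by_cases h2 : (O ∩ U ∩ Z).Nonempty
      · refine ⟨a, O ∩ U, hO.inter hU, h2, fun x hx => ?_⟩
        rw [hSa]
        exact ⟨hx.1.2, hOC ⟨hx.1.1, hx.2⟩⟩
      · refine ih O hO hne fun x hx => (h hx).resolve_left fun hxa => h2 ?_
        rw [hSa] at hxa
        exact ⟨x, ⟨hx.1, hxa.1⟩, hx.2⟩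

lemma exists_isLocallyClosed_disjoint {X ι : Type*} [TopologicalSpace X] {S : ι → Set X}
    (hS : ∀ i, IsLocallyClosed (S i)) (x : X) (s : Finset ι) (hx : ∀ i ∈ s, x ∉ S i) :
    ∃ T : Set X, IsLocallyClosed T ∧ x ∈ T ∧ ∀ i ∈ s, Disjoint T (S i) := by
  classical
  induction s using Finset.induction_on with
  | empty => exact ⟨Set.univ, isClosed_univ.isLocallyClosed, trivial, by simp⟩
  | insert a s _ ih =>
    obtain ⟨T, hT, hxT, hd⟩ := ih fun i hi => hx i (Finset.mem_insert_of_mem hi)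
    obtain ⟨U, C, hU, hC, hSa⟩ := hS a
    have : ∃ T' : Set X, IsLocallyClosed T' ∧ x ∈ T' ∧ Disjoint T' (S a) := by
      by_cases hxU : x ∈ U
      · refine ⟨Cᶜ, hC.isOpen_compl.isLocallyClosed, fun hxC => ?_, ?_⟩
        · exact hx a (Finset.mem_insert_self _ _) (hSa ▸ ⟨hxU, hxC⟩)
        · rw [hSa]
          exact disjoint_compl_left.mono_right Set.inter_subset_right
      · refine ⟨Uᶜ, hU.isClosed_compl.isLocallyClosed, hxU, ?_⟩
        rw [hSa]
        exact disjoint_compl_left.mono_right Set.inter_subset_left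
    obtain ⟨T', hT', hxT', hd'⟩ := this
    refine ⟨T ∩ T', hT.inter hT', ⟨hxT, hxT'⟩, fun i hi => ?_⟩
    rcases Finset.mem_insert.mp hi with rfl | hi
    · exact hd'.mono_left Set.inter_subset_right
    · exact (hd i hi).mono_left Set.inter_subset_left

/-- In a Jacobson space every nonempty locally closed set has a closed point; an uncovered point
would have a locally closed set around it missing all members. -/
lemma iUnion_eq_univ_of_closedPoints_subset {X ι : Type*} [TopologicalSpace X] [JacobsonSpace X]
    [Finite ι] {S : ι → Set X} (hS : ∀ i, IsLocallyClosed (S i))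
    (h : closedPoints X ⊆ ⋃ i, S i) : ⋃ i, S i = Set.univ := by
  cases nonempty_fintype ι
  by_contra hne
  obtain ⟨x, hx⟩ := (Set.ne_univ_iff_exists_notMem _).mp hne
  rw [Set.mem_iUnion, not_exists] at hx
  obtain ⟨T, hT, hxT, hd⟩ := exists_isLocallyClosed_disjoint hS x Finset.univ fun i _ => hx i
  obtain ⟨y, hyT, hy⟩ := nonempty_inter_closedPoints ⟨x, hxT⟩ hT
  obtain ⟨i, hi⟩ := Set.mem_iUnion.mp (h hy)
  exact Set.disjoint_left.mp (hd i (Finset.mem_univ i)) hyT hi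

/-! ### Rational points -/

/-- The point of the underlying space of a rational point. -/
def CPoints.pt {X : Over SpecC} (p : CPoints X) : X.left := p.left (IsLocalRing.closedPoint ℂ)

lemma CPoints.pt_comp {X Y : Over SpecC} (p : CPoints X) (f : X ⟶ Y) :
    CPoints.pt (p ≫ f) = f.left p.pt := by
  rfl

lemma CPoints.exists_comp_eq {A V : Over SpecC} (f : A ⟶ V) [IsImmersion f.left] (q : CPoints V)
    (h : q.pt ∈ Set.range f.left) : ∃ p : CPoints A, p ≫ f = q := by
  have : IsReduced (Over.mk (𝟙 SpecC)).left := inferInstanceAs (IsReduced SpecC)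
  refine exists_over_lift f q ?_
  rintro _ ⟨x, rfl⟩
  have : x = IsLocalRing.closedPoint ℂ :=
    Subsingleton.elim (α := PrimeSpectrum ℂ) x (IsLocalRing.closedPoint ℂ)
  rw [this]
  exact h

lemma CVariety.exists_pt_eq (V : CVariety) {x : V.toOver.left} (hx : x ∈ closedPoints _) :
    ∃ p : CPoints V.toOver, p.pt = x :=
  ⟨Over.homMk (pointOfClosedPoint V.toOver.hom x hx) (pointOfClosedPoint_comp _ _ _),
    pointOfClosedPoint_apply V.toOver.hom x hx _⟩

/-! ### Additivity of classes -/

/-- Noetherian induction on $Z$. Some nonempty relatively open $U \cap Z$ lies inside a single piece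
$D_i$. Cutting it off from both $W$ and $D_i$ removes the same class from the two sides and leaves
the smaller closed set $Z \setminus U$. -/
lemma varClass_eq_sum_of_closed (V : CVariety) (Z : TopologicalSpace.Closeds V.toOver.left) :
    ∀ (W : CVariety) (w : W.toOver ⟶ V.toOver), IsClosedImmersion w.left → Set.range w.left = Z →
    ∀ (k : ℕ) (D : Fin k → CVariety) (f : ∀ i, (D i).toOver ⟶ V.toOver),
      (∀ i, IsImmersion (f i).left) →
      Pairwise (fun i j => Disjoint (Set.range (f i).left) (Set.range (f j).left)) →
      ⋃ i, Set.range (f i).left = Z → varClass W = ∑ i, varClass (D i) := by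
  have wf : WellFoundedLT (TopologicalSpace.Closeds V.toOver.left) :=
    
    ((TopologicalSpace.noetherianSpace_TFAE V.toOver.left).out 0 1 :
      TopologicalSpace.NoetherianSpace V.toOver.left ↔ _).mp inferInstance
  induction Z using WellFoundedLT.induction with
  | ind Z ih =>
  intro W w hw hwZ k D f hf hd hU
  rcases (Z : Set V.toOver.left).eq_empty_or_nonempty with hZ | hZ
  · have key : ∀ (A : CVariety) (g : A.toOver ⟶ V.toOver), Set.range g.left ⊆ Z →
        varClass A = 0 := fun A g h => by
      have : IsEmpty A.toOver.left := ⟨fun x => by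
        have := h ⟨x, rfl⟩
        rw [hZ] at this
        exact this⟩
      exact varClass_eq_zero_of_isEmpty A
    rw [key W w hwZ.le, Finset.sum_eq_zero fun i _ => key _ (f i) ?_]
    rw [← hU]
    exact Set.subset_iUnion (fun i => Set.range (f i).left) i
  · obtain ⟨i, U, hUo, hUZ, hUi⟩ := exists_isOpen_inter_subset_of_subset_iUnion
      (fun i => (hf i).isLocallyClosed_range) (Z : Set V.toOver.left) Finset.univ Set.univ
      isOpen_univ (by simpa using hZ) (by simpa using hU.ge)
    have hiZ : Set.range (f i).left ⊆ Z := by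
      rw [← hU]
      exact Set.subset_iUnion (fun i => Set.range (f i).left) i
    let Z' : TopologicalSpace.Closeds V.toOver.left :=
      ⟨Z ∩ Uᶜ, Z.isClosed.inter hUo.isClosed_compl⟩
    have hlt : Z' < Z := by
      refine lt_of_le_of_ne (fun x hx => hx.1) fun h => ?_
      obtain ⟨x, hxU, hxZ⟩ := hUZ
      rw [← h] at hxZ
      exact hxZ.2 hxU
    obtain ⟨W₁, w₁, hw₁, hw₁r⟩ := W.exists_open (hUo.preimage w.left.continuous)
    obtain ⟨W₂, w₂, hw₂, hw₂r⟩ := W.exists_closed (hUo.preimage w.left.continuous).isClosed_compl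
    obtain ⟨E₁, e₁, he₁, he₁r⟩ := (D i).exists_open (hUo.preimage (f i).left.continuous)
    obtain ⟨E₂, e₂, he₂, he₂r⟩ :=
      (D i).exists_closed (hUo.preimage (f i).left.continuous).isClosed_compl
    have hi := hf i
    have r₁ : Set.range (w₁ ≫ w).left = U ∩ Z := by
      rw [Over.comp_left, Scheme.Hom.comp_base, TopCat.coe_comp, Set.range_comp, hw₁r,
        Set.image_preimage_eq_inter_range, hwZ]
    have r₂ : Set.range (w₂ ≫ w).left = Z' := by
      rw [Over.comp_left, Scheme.Hom.comp_base, TopCat.coe_comp, Set.range_comp, hw₂r,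
        ← Set.preimage_compl, Set.image_preimage_eq_inter_range, hwZ, Set.inter_comm]
      rfl
    have s₁ : Set.range (e₁ ≫ f i).left = U ∩ Z := by
      rw [Over.comp_left, Scheme.Hom.comp_base, TopCat.coe_comp, Set.range_comp, he₁r,
        Set.image_preimage_eq_inter_range]
      exact Set.Subset.antisymm (Set.inter_subset_inter_right _ hiZ)
        fun x hx => ⟨hx.1, hUi hx⟩
    have s₂ : Set.range (e₂ ≫ f i).left = Set.range (f i).left ∩ Uᶜ := by
      rw [Over.comp_left, Scheme.Hom.comp_base, TopCat.coe_comp, Set.range_comp, he₂r,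
        ← Set.preimage_compl, Set.image_preimage_eq_inter_range, Set.inter_comm]
    have i₁ : IsImmersion (w₁ ≫ w).left := by rw [Over.comp_left]; infer_instance
    have i₂ : IsClosedImmersion (w₂ ≫ w).left := by rw [Over.comp_left]; infer_instance
    have j₁ : IsImmersion (e₁ ≫ f i).left := by rw [Over.comp_left]; infer_instance
    have j₂ : IsImmersion (e₂ ≫ f i).left := by rw [Over.comp_left]; infer_instance
    have hW : varClass W = varClass W₁ + varClass W₂ :=
      varClass_scissor w₂ w₁ hw₂ hw₁ (by rw [hw₁r, hw₂r, compl_compl])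
    have hD : varClass (D i) = varClass E₁ + varClass E₂ :=
      varClass_scissor e₂ e₁ he₂ he₁ (by rw [he₁r, he₂r, compl_compl])
    have hE : varClass W₁ = varClass E₁ :=
      varClass_eq_of_range_eq (w₁ ≫ w) (e₁ ≫ f i) (r₁.trans s₁.symm)
    -- The family with $D_i$ replaced by $D_i \setminus U$. The other pieces are unchanged: being
    -- disjoint from $D_i \supseteq U \cap Z$, they do not meet $U$.
    let D' : Fin k → Σ A : CVariety, (A.toOver ⟶ V.toOver) :=
      fun j => if j = i then ⟨E₂, e₂ ≫ f i⟩ else ⟨D j, f j⟩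
    have hD'i : D' i = ⟨E₂, e₂ ≫ f i⟩ := if_pos rfl
    have hD'j : ∀ j, j ≠ i → D' j = ⟨D j, f j⟩ := fun j hj => if_neg hj
    have hD'r : ∀ j, Set.range (D' j).2.left = Set.range (f j).left ∩ Uᶜ := by
      intro j
      by_cases hj : j = i
      · subst hj
        rw [hD'i]
        exact s₂
      · rw [hD'j j hj]
        refine (Set.inter_eq_left.mpr fun x hx hxU => ?_).symm
        have hxZ : x ∈ (Z : Set V.toOver.left) := by
          rw [← hU]
          exact Set.mem_iUnion.mpr ⟨j, hx⟩
        exact Set.disjoint_left.mp (hd hj) hx (hUi ⟨hxU, hxZ⟩)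
    have hW₂ := ih Z' hlt W₂ (w₂ ≫ w) i₂ r₂ k (fun j => (D' j).1) (fun j => (D' j).2)
      (fun j => by
        by_cases hj : j = i
        · subst hj
          rw [hD'i]
          exact j₂
        · rw [hD'j j hj]
          exact hf j)
      (fun a b hab => by
        change Disjoint (Set.range (D' a).2.left) (Set.range (D' b).2.left)
        rw [hD'r, hD'r]
        exact (hd hab).mono Set.inter_subset_left Set.inter_subset_left)
      (by
        simp_rw [hD'r]
        rw [← Set.iUnion_inter, hU]
        rfl)
    rw [hW, hE, hW₂, ← Finset.add_sum_erase _ _ (Finset.mem_univ i),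
      ← Finset.add_sum_erase (a := i) _ (fun j => varClass (D j)) (Finset.mem_univ i), hD, hD'i,
      ← add_assoc]
    congr 1
    refine Finset.sum_congr rfl fun j hj => ?_
    rw [hD'j j (Finset.ne_of_mem_erase hj)]

/-- The class of a variety is the sum of the classes of the pieces of a partition into locally
closed subvarieties. -/
theorem varClass_eq_sum_of_partition (V : CVariety) {k : ℕ} (D : Fin k → CVariety)
    (f : ∀ i, (D i).toOver ⟶ V.toOver) (h : IsPartition Set.univ D f) :
    varClass V = ∑ i, varClass (D i) := by
  have himm := h.immersion
  refine varClass_eq_sum_of_closed V ⊤ V (𝟙 _) (by rw [Over.id_left]; infer_instance) (by simp)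
    k D f h.immersion ?_ ?_
  · intro i j hij
    rw [Set.disjoint_iff_inter_eq_empty, ← Set.not_nonempty_iff_eq_empty]
    intro hne
    -- Disjointness is only known for rational points. A nonempty overlap is locally closed, so it
    -- has a closed point, which is rational over $\mathbf C$.
    obtain ⟨x, ⟨hxi, hxj⟩, hx⟩ := nonempty_inter_closedPoints hne
      ((h.immersion i).isLocallyClosed_range.inter (h.immersion j).isLocallyClosed_range)
    obtain ⟨p, rfl⟩ := V.exists_pt_eq hx
    obtain ⟨a, ha⟩ := CPoints.exists_comp_eq (f i) p hxi
    obtain ⟨b, hb⟩ := CPoints.exists_comp_eq (f j) p hxj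
    exact Set.disjoint_left.mp (h.disjoint hij) ⟨a, ha⟩ ⟨b, hb⟩
  · refine iUnion_eq_univ_of_closedPoints_subset
      (fun i => (h.immersion i).isLocallyClosed_range) fun x hx => ?_
    obtain ⟨p, rfl⟩ := V.exists_pt_eq hx
    have hp : p ∈ ⋃ i, (Set.range fun p : CPoints (D i).toOver => p ≫ f i) :=
      h.iUnion_eq ▸ Set.mem_univ p
    obtain ⟨i, q, rfl⟩ := Set.mem_iUnion.mp hp
    exact Set.mem_iUnion.mpr ⟨i, q.pt, (CPoints.pt_comp q (f i)).symm⟩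

/-! ### The class of a constructible set is well defined -/

/-- `D` is the intersection of the two pieces with its reduced structure, built as the preimage in
`A` of the range of `g`. -/
lemma exists_refinement {X : Over SpecC} {A B : CVariety} (f : A.toOver ⟶ X) (g : B.toOver ⟶ X)
    [IsImmersion f.left] [IsImmersion g.left] :
    ∃ (D : CVariety) (a : D.toOver ⟶ A.toOver) (b : D.toOver ⟶ B.toOver),
      IsImmersion a.left ∧ IsImmersion b.left ∧ a ≫ f = b ≫ g ∧
      (∀ p : CPoints A.toOver, p ≫ f ∈ Set.range (fun q : CPoints B.toOver => q ≫ g) →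
        p ∈ Set.range (fun q : CPoints D.toOver => q ≫ a)) ∧
      (∀ p : CPoints B.toOver, p ≫ g ∈ Set.range (fun q : CPoints A.toOver => q ≫ f) →
        p ∈ Set.range (fun q : CPoints D.toOver => q ≫ b)) := by
  obtain ⟨D, a, ha, har⟩ := A.exists_locallyClosed
    ((‹IsImmersion g.left›.isLocallyClosed_range).preimage f.left.continuous)
  obtain ⟨b, hb⟩ := exists_over_lift g (a ≫ f) (by
    rw [Over.comp_left, Scheme.Hom.comp_base, TopCat.coe_comp, Set.range_comp, har]
    exact Set.image_preimage_subset _ _)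
  have hbi : IsImmersion b.left := by
    have : IsImmersion (b.left ≫ g.left) := by
      rw [← Over.comp_left, hb, Over.comp_left]
      infer_instance
    exact IsImmersion.of_comp _ g.left
  have h₁ : ∀ p : CPoints A.toOver, p ≫ f ∈ Set.range (fun q : CPoints B.toOver => q ≫ g) →
      p ∈ Set.range (fun q : CPoints D.toOver => q ≫ a) := by
    rintro p ⟨q, hq⟩
    refine CPoints.exists_comp_eq a p ?_
    rw [har]
    refine ⟨q.pt, ?_⟩
    rw [← CPoints.pt_comp, ← CPoints.pt_comp]
    exact congrArg CPoints.pt hq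
  refine ⟨D, a, b, ha, hbi, hb.symm, h₁, ?_⟩
  rintro p ⟨q, hq⟩
  have hg : Mono g := (Over.forget SpecC).mono_of_mono_map (inferInstanceAs (Mono g.left))
  obtain ⟨r, hr⟩ := h₁ q ⟨p, hq.symm⟩
  refine ⟨r, ?_⟩
  dsimp only at hr hq ⊢
  rw [← cancel_mono g, Category.assoc, hb, ← hq, ← hr, Category.assoc]

lemma IsPartition.eq_sum {X : Over SpecC} {C : Set (CPoints X)} {k l : ℕ} {A : Fin k → CVariety}
    {f : ∀ i, (A i).toOver ⟶ X} {B : Fin l → CVariety} {g : ∀ i, (B i).toOver ⟶ X}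
    (hA : IsPartition C A f) (hB : IsPartition C B g) (D : Fin k → Fin l → CVariety)
    (a : ∀ i j, (D i j).toOver ⟶ (A i).toOver) (ha : ∀ i j, IsImmersion (a i j).left)
    (b : ∀ i j, (D i j).toOver ⟶ (B j).toOver) (hab : ∀ i j, a i j ≫ f i = b i j ≫ g j)
    (h : ∀ i j (p : CPoints (A i).toOver),
      p ≫ f i ∈ Set.range (fun q : CPoints (B j).toOver => q ≫ g j) →
        p ∈ Set.range (fun q : CPoints (D i j).toOver => q ≫ a i j)) (i : Fin k) :
    varClass (A i) = ∑ j, varClass (D i j) := by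
  refine varClass_eq_sum_of_partition (A i) (D i) (a i) ⟨ha i, ?_, ?_⟩
  · intro j j' hj
    refine Set.disjoint_left.mpr ?_
    rintro _ ⟨p, rfl⟩ ⟨q, hq⟩
    refine Set.disjoint_left.mp (hB.disjoint hj) ⟨p ≫ b i j, rfl⟩ ⟨q ≫ b i j', ?_⟩
    dsimp only at hq ⊢
    rw [Category.assoc, Category.assoc, ← hab, ← hab, ← Category.assoc, hq, Category.assoc]
  · refine Set.eq_univ_of_forall fun p => ?_
    have hp : p ≫ f i ∈ C := by
      rw [← hA.iUnion_eq]
      exact Set.mem_iUnion.mpr ⟨i, p, rfl⟩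
    rw [← hB.iUnion_eq] at hp
    obtain ⟨j, hj⟩ := Set.mem_iUnion.mp hp
    exact Set.mem_iUnion.mpr ⟨j, h i j p hj⟩

/-- Two partitions have the common refinement by pairwise intersections $D_{ij}$; both sums equal
$\sum_{i,j} [D_{ij}]$. -/
theorem HasClass.unique {X : Over SpecC} {C : Set (CPoints X)} {x y : K0Var} (hx : HasClass C x)
    (hy : HasClass C y) : x = y := by
  obtain ⟨k, A, f, hA, rfl⟩ := hx
  obtain ⟨l, B, g, hB, rfl⟩ := hy
  have hf := hA.immersion
  have hg := hB.immersion
  choose D a b ha hb hab h₁ h₂ using fun i j => exists_refinement (f i) (g j)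
  rw [Finset.sum_congr rfl fun i _ => hA.eq_sum hB D a ha b hab h₁ i, Finset.sum_comm]
  exact (Finset.sum_congr rfl fun j _ => hB.eq_sum hA (fun j i => D i j) (fun j i => b i j)
    (fun j i => hb i j) (fun j i => a i j) (fun j i => (hab i j).symm) (fun j i => h₂ i j) j).symm

lemma HasClass.constructibleClass_eq {X : Over SpecC} {C : Set (CPoints X)} {x : K0Var}
    (hx : HasClass C x) : constructibleClass C = x := by
  have h : IsConstructibleSet C := ⟨x, hx⟩
  rw [constructibleClass, dif_pos h]
  exact h.choose_spec.unique hx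

/-! ### Morphisms of affine `ℂ`-schemes -/

section Affine

variable {A B C : Type} [CommRing A] [Algebra ℂ A] [CommRing B] [Algebra ℂ B]
  [CommRing C] [Algebra ℂ C]

/-- The morphism of affine `ℂ`-schemes with a given comorphism. -/
def specMap (α : A →ₐ[ℂ] B) : specOver B ⟶ specOver A :=
  Over.homMk (Spec.map (CommRingCat.ofHom α.toRingHom)) (by
    change Spec.map _ ≫ Spec.map _ = Spec.map _
    rw [← Spec.map_comp, ← CommRingCat.ofHom_comp]
    have : α.toRingHom.comp (algebraMap ℂ A) = algebraMap ℂ B := α.comp_algebraMap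
    rw [this])

lemma specMap_left (α : A →ₐ[ℂ] B) :
    (specMap α).left = Spec.map (CommRingCat.ofHom α.toRingHom) := rfl

lemma specMap_comp (α : A →ₐ[ℂ] B) (ψ : B →ₐ[ℂ] C) :
    specMap (ψ.comp α) = specMap ψ ≫ specMap α := by
  ext : 1
  change Spec.map _ = Spec.map _ ≫ Spec.map _
  rw [← Spec.map_comp, ← CommRingCat.ofHom_comp]
  rfl

lemma specMap_id : specMap (AlgHom.id ℂ A) = 𝟙 _ := by
  ext : 1
  exact Spec.map_id _

/-- The rational point of an affine `ℂ`-scheme given by a character of its coordinate ring. -/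
def cpoint (α : A →ₐ[ℂ] ℂ) : CPoints (specOver A) :=
  Over.homMk (Spec.map (CommRingCat.ofHom α.toRingHom)) (by
    change Spec.map _ ≫ Spec.map _ = 𝟙 _
    rw [← Spec.map_comp, ← CommRingCat.ofHom_comp]
    have : α.toRingHom.comp (algebraMap ℂ A) = RingHom.id ℂ := α.comp_algebraMap
    rw [this, CommRingCat.ofHom_id, Spec.map_id])

lemma cpoint_comp_specMap (α : A →ₐ[ℂ] B) (p : B →ₐ[ℂ] ℂ) :
    cpoint p ≫ specMap α = cpoint (p.comp α) := by
  ext : 1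
  change Spec.map _ ≫ Spec.map _ = Spec.map _
  rw [← Spec.map_comp, ← CommRingCat.ofHom_comp]
  rfl

lemma cpoint_injective : Function.Injective (cpoint : (A →ₐ[ℂ] ℂ) → _) := by
  intro α ψ h
  have h' := congrArg (fun f => f.left) h
  have := Spec.map_injective h'
  ext a
  exact congrArg (fun f => f.hom a) this

lemma cpoint_surjective : Function.Surjective (cpoint : (A →ₐ[ℂ] ℂ) → _) := by
  intro p
  obtain ⟨f, hf⟩ := Spec.map_surjective (R := CommRingCat.of A) (S := CommRingCat.of ℂ) p.left
  have hw : p.left ≫ (specOver A).hom = 𝟙 _ := Over.w p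
  have hf' : CommRingCat.ofHom (algebraMap ℂ A) ≫ f = 𝟙 _ := by
    apply Spec.map_injective
    rw [Spec.map_comp, hf, Spec.map_id]
    exact hw
  refine ⟨⟨f.hom, fun c => ?_⟩, ?_⟩
  · exact congrArg (fun g => g.hom c) hf'
  · ext : 1
    exact hf

lemma range_cpoint_comp (α : A →ₐ[ℂ] B) :
    Set.range (fun p : CPoints (specOver B) => p ≫ specMap α) =
      Set.range fun p : B →ₐ[ℂ] ℂ => cpoint (p.comp α) := by
  rw [← cpoint_surjective.range_comp]
  refine congrArg Set.range (funext fun p => ?_)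
  exact cpoint_comp_specMap α p

/-- The hypotheses say that `α` extends to a surjection from the localization of `A` at `x`, so the
morphism is a closed immersion into the basic open set of `x`. -/
lemma isImmersion_specMap (α : A →ₐ[ℂ] B) (x : A) (hx : IsUnit (α x))
    (h : ∀ b, ∃ (n : ℕ) (a : A), α a = α x ^ n * b) : IsImmersion (specMap α).left := by
  let l : Localization.Away x →+* B := IsLocalization.Away.lift x (g := α.toRingHom) hx
  have hl : l.comp (algebraMap A (Localization.Away x)) = α.toRingHom :=
    IsLocalization.Away.lift_comp x hx
  have hsurj : Function.Surjective l := by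
    intro b
    obtain ⟨n, a, ha⟩ := h b
    refine ⟨IsLocalization.mk' _ a (⟨x ^ n, n, rfl⟩ : Submonoid.powers x), ?_⟩
    refine (IsLocalization.lift_mk'_spec _ _ _ _).mpr ?_
    simpa using ha
  have h1 : IsImmersion (Spec.map (CommRingCat.ofHom l)) := by
    have := IsClosedImmersion.spec_of_surjective (CommRingCat.ofHom l) hsurj
    infer_instance
  have h2 : IsImmersion (Spec.map (CommRingCat.ofHom (algebraMap A (Localization.Away x)))) := by
    have : IsOpenImmersion (Spec.map
        (CommRingCat.ofHom (algebraMap A (Localization.Away x)))) :=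
      IsOpenImmersion.of_isLocalization x
    infer_instance
  rw [specMap_left, ← hl, CommRingCat.ofHom_comp, Spec.map_comp]
  exact @IsImmersion.comp _ _ _ _ _ h1 h2

end Affine

/-! ### Classes of affine varieties -/

section Classes

instance isReduced_polynomial (A : Type) [CommRing A] [_root_.IsReduced A] :
    _root_.IsReduced A[X] := by
  refine ⟨fun f hf => Polynomial.ext fun i => ?_⟩
  rw [Polynomial.coeff_zero]
  exact (Polynomial.isNilpotent_iff.mp hf i).eq_zero

variable (A B : Type) [CommRing A] [Algebra ℂ A] [_root_.IsReduced A] [Algebra.FiniteType ℂ A]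
  [CommRing B] [Algebra ℂ B] [_root_.IsReduced B] [Algebra.FiniteType ℂ B]

variable {A B} in
lemma varClass_ofAlgebra_congr (e : A ≃ₐ[ℂ] B) :
    varClass (CVariety.ofAlgebra A) = varClass (CVariety.ofAlgebra B) :=
  varClass_eq_of_iso (X := CVariety.ofAlgebra A) (Y := CVariety.ofAlgebra B)
    ⟨specMap e.symm.toAlgHom, specMap e.toAlgHom,
      (specMap_comp e.toAlgHom e.symm.toAlgHom).symm.trans (by
        rw [show e.symm.toAlgHom.comp e.toAlgHom = AlgHom.id ℂ A by ext; simp]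
        exact specMap_id),
      (specMap_comp e.symm.toAlgHom e.toAlgHom).symm.trans (by
        rw [show e.toAlgHom.comp e.symm.toAlgHom = AlgHom.id ℂ B by ext; simp]
        exact specMap_id)⟩

lemma varClass_point : varClass (CVariety.ofAlgebra ℂ) = 1 := by
  have := RingQuot.mkRingHom_rel K0Rel.point
  rw [map_one] at this
  exact this

/-- $A[X]$ is the pushout of $A$ and $\mathbf C[X]$ over $\mathbf C$, so its spectrum is the product
of $\operatorname{Spec} A$ with the line. -/
lemma varClass_polynomial :
    varClass (CVariety.ofAlgebra A[X]) = lefschetz * varClass (CVariety.ofAlgebra A) := by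
  have := RingQuot.mkRingHom_rel (K0Rel.prod (CVariety.ofAlgebra ℂ[X]) (CVariety.ofAlgebra A)
    (CVariety.ofAlgebra A[X]) (specMap (Polynomial.mapAlgHom (Algebra.ofId ℂ A)))
    (specMap (Algebra.algHom ℂ A A[X])) ?_)
  · rw [map_mul] at this
    exact this.symm
  · let : Algebra ℂ[X] A[X] := (Polynomial.mapRingHom (algebraMap ℂ A)).toAlgebra
    exact isPullback_SpecMap_of_isPushout _ _ _ _ (CommRingCat.isPushout_of_isPushout ℂ ℂ[X] A A[X])

lemma varClass_mvPolynomial (k : ℕ) :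
    varClass (CVariety.ofAlgebra (MvPolynomial (Fin k) A)) =
      lefschetz ^ k * varClass (CVariety.ofAlgebra A) := by
  induction k with
  | zero =>
    rw [pow_zero, one_mul]
    exact varClass_ofAlgebra_congr ((MvPolynomial.isEmptyAlgEquiv A (Fin 0)).restrictScalars ℂ)
  | succ k ih =>
    rw [pow_succ', mul_assoc, ← ih, ← varClass_polynomial]
    exact varClass_ofAlgebra_congr ((MvPolynomial.finSuccEquiv A k).restrictScalars ℂ)

lemma varClass_laurentPolynomial :
    varClass (CVariety.ofAlgebra (LaurentPolynomial ℂ)) = lefschetz - 1 := by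
  have hop : IsOpenImmersion (Spec.map (CommRingCat.ofHom
      (algebraMap ℂ[X] (LaurentPolynomial ℂ)))) :=
    IsOpenImmersion.of_isLocalization (Polynomial.X : ℂ[X])
  have hcl : IsClosedImmersion (Spec.map (CommRingCat.ofHom
      (Polynomial.aeval (0 : ℂ) : ℂ[X] →ₐ[ℂ] ℂ).toRingHom)) :=
    IsClosedImmersion.spec_of_surjective _ fun c => ⟨Polynomial.C c, by simp⟩
  have := varClass_scissor (X := CVariety.ofAlgebra ℂ[X]) (Z := CVariety.ofAlgebra ℂ)
    (U := CVariety.ofAlgebra (LaurentPolynomial ℂ))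
    (specMap (Polynomial.aeval 0)) (specMap (Polynomial.toLaurentAlg))
    hcl hop ?_
  · rw [varClass_point] at this
    exact eq_sub_of_add_eq this.symm
  · have h1 : Set.range (specMap (Polynomial.toLaurentAlg)).left =
        (PrimeSpectrum.basicOpen (Polynomial.X : ℂ[X]) : Set (PrimeSpectrum ℂ[X])) :=
      PrimeSpectrum.localization_away_comap_range (LaurentPolynomial ℂ) (Polynomial.X : ℂ[X])
    have h2 : Set.range (specMap (Polynomial.aeval (0 : ℂ) : ℂ[X] →ₐ[ℂ] ℂ)).left =
        PrimeSpectrum.zeroLocus {(Polynomial.X : ℂ[X])} := by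
      have := range_comap_of_surjective ℂ (Polynomial.aeval (0 : ℂ) : ℂ[X] →ₐ[ℂ] ℂ).toRingHom
        fun c => ⟨Polynomial.C c, by simp⟩
      refine this.trans ?_
      rw [← PrimeSpectrum.zeroLocus_span {(Polynomial.X : ℂ[X])}]
      refine congrArg (fun I : Ideal ℂ[X] => PrimeSpectrum.zeroLocus (I : Set ℂ[X]))
        (Ideal.ext fun f => ?_)
      change Polynomial.aeval (0 : ℂ) f = 0 ↔ _
      rw [Ideal.mem_span_singleton, Polynomial.X_dvd_iff,
        Polynomial.coeff_zero_eq_aeval_zero]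
    exact h1.trans ((PrimeSpectrum.basicOpen_eq_zeroLocus_compl _).trans
      (congrArg compl h2.symm))

end Classes

/-! ### Families of arcs and jets -/

section JetFamilies

variable {R : Type} [CommRing R] [Algebra ℂ R] {A : Type} [CommRing A] [Algebra ℂ A]

/-- The reduced jet space involves the radical of the relations; since $A$ is a domain the kernel is
prime, so it contains the radical as soon as it contains the relations. -/
lemma jetRelations_le_ker_of_family [IsDomain A] (s : ℕ) (h : R →ₐ[ℂ] A⟦X⟧) :
    (Ideal.span (jetRelations R s)).radical ≤
      RingHom.ker (MvPolynomial.aeval (R := ℂ)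
        (fun p : R × Fin (s + 1) => PowerSeries.coeff (p.2 : ℕ) (h p.1))) := by
  set ev : MvPolynomial (R × Fin (s + 1)) ℂ →ₐ[ℂ] A := MvPolynomial.aeval (R := ℂ)
    (fun p : R × Fin (s + 1) => PowerSeries.coeff (p.2 : ℕ) (h p.1)) with hev
  have key : ∀ (f : R) (k : ℕ), k ≤ s →
      ev ((universalJet s f).coeff k) = PowerSeries.coeff k (h f) := by
    intro f k hk
    have : (universalJet s f).coeff k =
        MvPolynomial.X (f, (⟨k, Nat.lt_succ_of_le hk⟩ : Fin (s + 1))) := by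
      rw [universalJet, Polynomial.finsetSum_coeff,
        Finset.sum_eq_single (⟨k, Nat.lt_succ_of_le hk⟩ : Fin (s + 1))]
      · simp
      · intro b _ hb
        rw [Polynomial.coeff_monomial, if_neg]
        intro hbk
        exact hb (Fin.ext hbk)
      · simp
    rw [this, hev, MvPolynomial.aeval_X]
  refine (Ideal.IsRadical.radical_le_iff ?_).mpr (Ideal.span_le.mpr ?_)
  · exact (RingHom.ker_isPrime ev.toRingHom).isRadical
  rintro x ⟨k, hk, ⟨f, g, rfl⟩ | ⟨f, g, rfl⟩ | ⟨c, rfl⟩⟩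
  · change ev _ = 0
    simp [key _ k hk]
  · change ev _ = 0
    rw [Polynomial.coeff_sub, map_sub, key _ k hk, Polynomial.coeff_mul, map_mul,
      PowerSeries.coeff_mul, map_sum, sub_eq_zero]
    refine Finset.sum_congr rfl fun p hp => ?_
    have hp' := Finset.HasAntidiagonal.mem_antidiagonal.mp hp
    rw [map_mul, key _ _ (by omega), key _ _ (by omega)]
  · change ev _ = 0
    rw [Polynomial.coeff_sub, map_sub, key _ k hk, AlgHom.commutes, Polynomial.coeff_C,
      PowerSeries.algebraMap_apply, PowerSeries.coeff_C]
    split_ifs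
    · rw [sub_eq_zero, MvPolynomial.algHom_C]
    · simp

/-- The morphism to the `s`-jet space defined by a family of arcs parametrized by `Spec A`. -/
def jetHomFamily [IsDomain A] (s : ℕ) (h : R →ₐ[ℂ] A⟦X⟧) : JetRing R s →ₐ[ℂ] A :=
  Ideal.Quotient.liftₐ _
    (MvPolynomial.aeval fun p : R × Fin (s + 1) => PowerSeries.coeff (p.2 : ℕ) (h p.1))
    fun _ ha => jetRelations_le_ker_of_family s h ha

/-- The coordinate `f^{(j)}` on the `s`-jet space. -/
def jetCoord (s : ℕ) (f : R) (j : Fin (s + 1)) : JetRing R s :=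
  Ideal.Quotient.mk _ (MvPolynomial.X (f, j))

lemma jetHomFamily_jetCoord [IsDomain A] (s : ℕ) (h : R →ₐ[ℂ] A⟦X⟧) (f : R) (j : Fin (s + 1)) :
    jetHomFamily s h (jetCoord s f j) = PowerSeries.coeff (j : ℕ) (h f) :=
  MvPolynomial.aeval_X _ _

lemma jetHom_jetCoord (s : ℕ) (h : Arc R) (f : R) (j : Fin (s + 1)) :
    jetHom s h (jetCoord s f j) = PowerSeries.coeff (j : ℕ) (h f) :=
  MvPolynomial.aeval_X _ _

lemma jetRing_algHom_ext {s : ℕ} {α β : JetRing R s →ₐ[ℂ] A}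
    (h : ∀ f j, α (jetCoord s f j) = β (jetCoord s f j)) : α = β := by
  refine Ideal.Quotient.algHom_ext _ ?_
  ext ⟨f, j⟩
  exact h f j

lemma jetRing_range_le {s : ℕ} (α : JetRing R s →ₐ[ℂ] A) (S : Subalgebra ℂ A)
    (h : ∀ f j, α (jetCoord s f j) ∈ S) : α.range ≤ S := by
  rintro _ ⟨x, rfl⟩
  obtain ⟨x, rfl⟩ := Ideal.Quotient.mk_surjective x
  induction x using MvPolynomial.induction_on with
  | C a => exact (α.commutes a).symm ▸ S.algebraMap_mem a
  | add p q hp hq =>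
    rw [map_add]
    exact (map_add α _ _).symm ▸ S.add_mem hp hq
  | mul_X p i hp =>
    rw [map_mul]
    exact (map_mul α _ _).symm ▸ S.mul_mem hp (h i.1 i.2)

lemma comp_jetHomFamily [IsDomain A] (s : ℕ) (h : R →ₐ[ℂ] A⟦X⟧) (q : A →ₐ[ℂ] ℂ) :
    q.comp (jetHomFamily s h) = jetHom s ((PowerSeries.mapAlgHom q).comp h) := by
  refine jetRing_algHom_ext fun f j => ?_
  rw [AlgHom.comp_apply, jetHomFamily_jetCoord, jetHom_jetCoord, AlgHom.comp_apply,
    PowerSeries.mapAlgHom_apply, PowerSeries.coeff_map]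
  rfl

lemma jet_eq_cpoint (s : ℕ) (h : Arc R) : jet s h = cpoint (jetHom s h) := rfl

lemma jet_eq_jet_iff (s : ℕ) (h h' : Arc R) :
    jet s h = jet s h' ↔
      ∀ f, ∀ j ≤ s, PowerSeries.coeff j (h f) = PowerSeries.coeff j (h' f) := by
  rw [jet_eq_cpoint, jet_eq_cpoint, cpoint_injective.eq_iff]
  constructor
  · intro e f j hj
    have := congrArg (fun α => α (jetCoord s f ⟨j, Nat.lt_succ_of_le hj⟩)) e
    simpa only [jetHom_jetCoord] using this
  · intro e
    refine jetRing_algHom_ext fun f j => ?_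
    rw [jetHom_jetCoord, jetHom_jetCoord]
    exact e f j (Nat.le_of_lt_succ j.2)

lemma jet_eq_jet_iff_single {P : Type} [AddCommMonoid P] (s : ℕ)
    (h h' : Arc (AddMonoidAlgebra ℂ P)) :
    jet s h = jet s h' ↔ ∀ u, ∀ j ≤ s, PowerSeries.coeff j (h (AddMonoidAlgebra.single u 1)) =
      PowerSeries.coeff j (h' (AddMonoidAlgebra.single u 1)) := by
  rw [jet_eq_jet_iff]
  refine ⟨fun e u => e _, fun e f j hj => ?_⟩
  induction f using AddMonoidAlgebra.induction_on with
  | of u => exact e u j hj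
  | add x y hx hy => rw [map_add, map_add, map_add, map_add, hx, hy]
  | smul r x hx => rw [map_smul, map_smul, map_smul, map_smul, hx]

end JetFamilies

/-! ### Monomial arcs -/

section MonomialArcs

variable {P : Type} [AddCommMonoid P] {A B : Type} [CommRing A] [Algebra ℂ A] [CommRing B]
  [Algebra ℂ B]

/-- The family of arcs `X^u ↦ f^{δ(u)}`. -/
def monomialArc (δ : P →+ ℕ) (f : A⟦X⟧) : AddMonoidAlgebra ℂ P →ₐ[ℂ] A⟦X⟧ :=
  AddMonoidAlgebra.lift ℂ A⟦X⟧ P ((powersHom A⟦X⟧ f).comp (AddMonoidHom.toMultiplicative δ))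

lemma monomialArc_single (δ : P →+ ℕ) (f : A⟦X⟧) (u : P) :
    monomialArc δ f (AddMonoidAlgebra.single u 1) = f ^ δ u := by
  rw [monomialArc, AddMonoidAlgebra.lift_single, one_smul]
  simp

lemma eq_monomialArc (δ : P →+ ℕ) (f : A⟦X⟧) (h : AddMonoidAlgebra ℂ P →ₐ[ℂ] A⟦X⟧)
    (hf : ∀ u, h (AddMonoidAlgebra.single u 1) = f ^ δ u) : h = monomialArc δ f := by
  refine AddMonoidAlgebra.algHom_ext (fun u => ?_) (by ext)
  rw [hf, monomialArc_single]

lemma mapAlgHom_comp_monomialArc (δ : P →+ ℕ) (f : A⟦X⟧) (q : A →ₐ[ℂ] B) :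
    (PowerSeries.mapAlgHom q).comp (monomialArc δ f) =
      monomialArc δ (PowerSeries.map q.toRingHom f) := by
  refine eq_monomialArc _ _ _ fun u => ?_
  rw [AlgHom.comp_apply, monomialArc_single, map_pow]
  rfl

end MonomialArcs

/-! ### Powers of power series -/

section Powers

variable {A B : Type} [CommRing A] [CommRing B]

/-- The series `1 + ∑_{j < k} a_j t^{j+1}`. -/
def unitSeries {k : ℕ} (a : Fin k → A) : A⟦X⟧ :=
  PowerSeries.mk fun i => if i = 0 then 1 else if h : i - 1 < k then a ⟨i - 1, h⟩ else 0

lemma coeff_unitSeries_zero {k : ℕ} (a : Fin k → A) : PowerSeries.coeff 0 (unitSeries a) = 1 := by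
  simp [unitSeries]

lemma coeff_unitSeries_succ {k : ℕ} (a : Fin k → A) (j : Fin k) :
    PowerSeries.coeff (j + 1 : ℕ) (unitSeries a) = a j := by
  simp [unitSeries]

lemma map_unitSeries {k : ℕ} (a : Fin k → A) (f : A →+* B) :
    PowerSeries.map f (unitSeries a) = unitSeries fun j => f (a j) := by
  ext i
  rw [PowerSeries.coeff_map, unitSeries, unitSeries, PowerSeries.coeff_mk, PowerSeries.coeff_mk]
  split_ifs <;> simp

/-- Factor $w^m - v^m = (w-v)\sum_i w^i v^{m-1-i}$: the first factor is divisible by $t^J$, and the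
second has constant term $m$. -/
lemma coeff_pow_eq_add {w v : A⟦X⟧} {J : ℕ}
    (h : ∀ i < J, PowerSeries.coeff i w = PowerSeries.coeff i v)
    (hw : PowerSeries.coeff 0 w = 1) (hv : PowerSeries.coeff 0 v = 1) (m : ℕ) :
    PowerSeries.coeff J (w ^ m) = PowerSeries.coeff J (v ^ m) +
      m * (PowerSeries.coeff J w - PowerSeries.coeff J v) := by
  obtain ⟨r, hr⟩ : PowerSeries.X ^ J ∣ w - v := by
    rw [PowerSeries.X_pow_dvd_iff]
    intro i hi
    rw [map_sub, h i hi, sub_self]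
  have h1 := geom_sum₂_mul w v m
  rw [hr, mul_left_comm] at h1
  have h2 := congrArg (PowerSeries.coeff J) h1
  have h3 := congrArg (PowerSeries.coeff J) hr
  rw [PowerSeries.coeff_X_pow_mul', if_pos le_rfl, Nat.sub_self] at h2 h3
  rw [map_sub] at h2 h3
  rw [h3, ← sub_eq_iff_eq_add', ← h2]
  simp only [PowerSeries.coeff_zero_eq_constantCoeff_apply] at hw hv ⊢
  simp [hw, hv]

lemma coeff_pow_mem {A : Type} [CommRing A] [Algebra ℂ A] (S : Subalgebra ℂ A) {v : A⟦X⟧}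
    (h : ∀ i, PowerSeries.coeff i v ∈ S) (m i : ℕ) : PowerSeries.coeff i (v ^ m) ∈ S := by
  have : v = PowerSeries.map S.val.toRingHom (PowerSeries.mk fun i => ⟨_, h i⟩) := by
    ext i
    simp
  rw [this, ← map_pow, PowerSeries.coeff_map]
  exact Subtype.coe_prop _

/-- The lower coefficients of a unit series are determined by those of a power of it. -/
lemma coeff_mem_of_coeff_pow_mem {A : Type} [CommRing A] [Algebra ℂ A] (S : Subalgebra ℂ A)
    {w : A⟦X⟧} (hw : PowerSeries.coeff 0 w = 1) {m : ℕ} (hm : m ≠ 0) {k : ℕ}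
    (h : ∀ i ≤ k, PowerSeries.coeff i (w ^ m) ∈ S) : ∀ i ≤ k, PowerSeries.coeff i w ∈ S := by
  intro J
  induction J using Nat.strong_induction_on with
  | _ J ih =>
    intro hJ
    rcases Nat.eq_zero_or_pos J with rfl | hJ0
    · rw [hw]
      exact S.one_mem
    -- Truncate $w$ below degree $J$. Then $[t^J]w^m = [t^J]v^m + m\,[t^J]w$, where $[t^J]v^m$ lies
    -- in $S$ by induction and $m$ is invertible in $\mathbf C$.
    let v : A⟦X⟧ := PowerSeries.mk fun i => if i < J then PowerSeries.coeff i w else 0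
    have hv : ∀ i, PowerSeries.coeff i v = if i < J then PowerSeries.coeff i w else 0 :=
      fun i => PowerSeries.coeff_mk _ _
    have hvS : ∀ i, PowerSeries.coeff i v ∈ S := by
      intro i
      rw [hv]
      split_ifs with hi
      · exact ih i hi (by omega)
      · exact S.zero_mem
    have e := coeff_pow_eq_add (w := w) (v := v) (J := J) (fun i hi => by rw [hv, if_pos hi]) hw
      (by rw [hv, if_pos hJ0, hw]) m
    rw [hv J, if_neg (lt_irrefl J), sub_zero] at e
    have h1 : (m : A) * PowerSeries.coeff J w ∈ S := by
      rw [← sub_eq_iff_eq_add'.mpr e]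
      exact S.sub_mem (h J hJ) (coeff_pow_mem S hvS m J)
    have h2 : PowerSeries.coeff J w = ((m : ℂ)⁻¹) • ((m : A) * PowerSeries.coeff J w) := by
      rw [← map_natCast (algebraMap ℂ A) m, ← Algebra.smul_def, smul_smul,
        inv_mul_cancel₀ (Nat.cast_ne_zero.mpr hm), one_smul]
    rw [h2]
    exact S.smul_mem h1 _

lemma coeff_C_mul_X_pow_mul_pow (c : A) (n e i : ℕ) (w : A⟦X⟧) :
    PowerSeries.coeff i ((PowerSeries.C c * PowerSeries.X ^ n * w) ^ e) =
      if n * e ≤ i then c ^ e * PowerSeries.coeff (i - n * e) (w ^ e) else 0 := by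
  rw [mul_pow, mul_pow, ← map_pow, ← pow_mul, mul_assoc, PowerSeries.coeff_C_mul,
    PowerSeries.coeff_X_pow_mul']
  split_ifs <;> simp

lemma coeff_pow_eq_of_coeff_eq {w v : A⟦X⟧} {k : ℕ}
    (h : ∀ i ≤ k, PowerSeries.coeff i w = PowerSeries.coeff i v) (m i : ℕ) (hi : i ≤ k) :
    PowerSeries.coeff i (w ^ m) = PowerSeries.coeff i (v ^ m) := by
  have h1 : PowerSeries.X ^ (k + 1) ∣ w - v := by
    rw [PowerSeries.X_pow_dvd_iff]
    intro i hi
    rw [map_sub, h i (by omega), sub_self]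
  have h2 := (PowerSeries.X_pow_dvd_iff.mp (h1.trans (sub_dvd_pow_sub_pow w v m))) i (by omega)
  rwa [map_sub, sub_eq_zero] at h2

end Powers

/-! ### The strata of jets of monomial arcs of given order -/

section Strata

lemma coeff_zero_unitSeries_pow {A : Type} [CommRing A] {k : ℕ} (a : Fin k → A) (m : ℕ) :
    PowerSeries.coeff 0 (unitSeries a ^ m) = 1 := by
  have h := coeff_unitSeries_zero a
  rw [PowerSeries.coeff_zero_eq_constantCoeff_apply] at h ⊢
  rw [map_pow, h, one_pow]

/-- The coordinate ring of `𝔾ₘ × 𝔸ᵏ`. -/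
abbrev StratumRing (k : ℕ) : Type := MvPolynomial (Fin k) (LaurentPolynomial ℂ)

lemma varClass_stratumRing (k : ℕ) :
    varClass (CVariety.ofAlgebra (StratumRing k)) = (lefschetz - 1) * lefschetz ^ k := by
  rw [varClass_mvPolynomial, varClass_laurentPolynomial, mul_comm]

variable {k : ℕ}

/-- The character `y^i` of `𝔾ₘ`. -/
def torusChar (k : ℕ) (i : ℤ) : StratumRing k := MvPolynomial.C (LaurentPolynomial.T i)

lemma torusChar_add (i j : ℤ) : torusChar k (i + j) = torusChar k i * torusChar k j := by
  rw [torusChar, LaurentPolynomial.T_add, map_mul]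
  rfl

lemma torusChar_zero : torusChar k 0 = 1 := by
  rw [torusChar, LaurentPolynomial.T_zero, map_one]

lemma torusChar_pow (i : ℤ) (n : ℕ) : torusChar k i ^ n = torusChar k (n * i) := by
  rw [torusChar, ← map_pow, LaurentPolynomial.T_pow]
  rfl

lemma isUnit_torusChar (i : ℤ) : IsUnit (torusChar k i) :=
  IsUnit.of_mul_eq_one (torusChar k (-i)) (by rw [← torusChar_add, add_neg_cancel, torusChar_zero])

/-- A subalgebra which contains all characters and coordinates is everything. -/
lemma stratumRing_subalgebra_eq_top (S : Subalgebra ℂ (StratumRing k))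
    (hT : ∀ i, torusChar k i ∈ S) (hX : ∀ j, MvPolynomial.X j ∈ S) : S = ⊤ := by
  refine Algebra.eq_top_iff.mpr fun x => ?_
  induction x using MvPolynomial.induction_on with
  | C a =>
    induction a using LaurentPolynomial.induction_on' with
    | add p q hp hq =>
      rw [map_add]
      exact S.add_mem hp hq
    | C_mul_T n a =>
      rw [map_mul]
      exact S.mul_mem (S.algebraMap_mem a) (hT n)
  | add p q hp hq => exact S.add_mem hp hq
  | mul_X p i hp => exact S.mul_mem hp (hX i)

lemma stratumRing_algHom_ext {A : Type} [CommRing A] [Algebra ℂ A] {p q : StratumRing k →ₐ[ℂ] A}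
    (hT : p (torusChar k 1) = q (torusChar k 1))
    (hX : ∀ j, p (MvPolynomial.X j) = q (MvPolynomial.X j)) : p = q := by
  have hn : p (torusChar k (-1)) = q (torusChar k (-1)) := by
    have h1 : p (torusChar k 1) * p (torusChar k (-1)) = 1 := by
      rw [← map_mul, ← torusChar_add, add_neg_cancel, torusChar_zero, map_one]
    have h2 : p (torusChar k 1) * q (torusChar k (-1)) = 1 := by
      rw [hT, ← map_mul, ← torusChar_add, add_neg_cancel, torusChar_zero, map_one]
    exact ((isUnit_torusChar 1).map p).mul_left_cancel (h1.trans h2.symm)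
  have := stratumRing_subalgebra_eq_top (AlgHom.equalizer p q) (fun i => ?_) hX
  · ext x
    · exact (this ▸ Algebra.mem_top :
        (algebraMap (LaurentPolynomial ℂ) (StratumRing k) _) ∈ AlgHom.equalizer p q)
    · exact hX x
  · obtain ⟨n, rfl | rfl⟩ := i.eq_nat_or_neg
    · rw [← mul_one (n : ℤ), ← torusChar_pow]
      exact pow_mem (S := AlgHom.equalizer p q) hT n
    · rw [← mul_neg_one, ← torusChar_pow]
      exact pow_mem (S := AlgHom.equalizer p q) hn n

/-- The rational point of `𝔾ₘ × 𝔸ᵏ` with given coordinates. -/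
def stratumPoint (c : ℂˣ) (a : Fin k → ℂ) : StratumRing k →ₐ[ℂ] ℂ :=
  MvPolynomial.aevalTower
    (AddMonoidAlgebra.lift ℂ ℂ ℤ ((Units.coeHom ℂ).comp (zpowersHom ℂˣ c))) a

lemma stratumPoint_torusChar (c : ℂˣ) (a : Fin k → ℂ) (i : ℤ) :
    stratumPoint c a (torusChar k i) = (c : ℂ) ^ i := by
  rw [stratumPoint, torusChar, MvPolynomial.aevalTower_C]
  refine (AddMonoidAlgebra.lift_single _ i (1 : ℂ)).trans ?_
  simp

lemma stratumPoint_X (c : ℂˣ) (a : Fin k → ℂ) (j : Fin k) :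
    stratumPoint c a (MvPolynomial.X j) = a j :=
  MvPolynomial.aevalTower_X _ _ _

/-- The map `(c, a) ↦ (c^g, a)` from `𝔾ₘ × 𝔸ᵏ` to itself. -/
def stratumPow (k g : ℕ) : StratumRing k →ₐ[ℂ] StratumRing k :=
  MvPolynomial.mapAlgHom (AddMonoidAlgebra.mapDomainAlgHom ℂ ℂ (zmultiplesHom ℤ (g : ℤ)))

lemma stratumPow_torusChar (g : ℕ) (i : ℤ) :
    stratumPow k g (torusChar k i) = torusChar k (i * g) := by
  refine (MvPolynomial.map_C _ _).trans (congrArg MvPolynomial.C ?_)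
  refine (AddMonoidAlgebra.mapDomain_single).trans ?_
  rw [zmultiplesHom_apply, smul_eq_mul]
  rfl

lemma stratumPow_X (g : ℕ) (j : Fin k) :
    stratumPow k g (MvPolynomial.X j) = MvPolynomial.X j := MvPolynomial.map_X _ _

lemma stratumPow_injective {g : ℕ} (hg : g ≠ 0) : Function.Injective (stratumPow k g) := by
  refine MvPolynomial.map_injective _ (AddMonoidAlgebra.mapDomain_injective fun i j h => ?_)
  simpa [hg] using h

lemma stratumPoint_comp_stratumPow (c : ℂˣ) (a : Fin k → ℂ) (g : ℕ) :
    (stratumPoint c a).comp (stratumPow k g) = stratumPoint (c ^ g) a := by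
  refine stratumRing_algHom_ext ?_ fun j => ?_
  · rw [AlgHom.comp_apply, stratumPow_torusChar, stratumPoint_torusChar, stratumPoint_torusChar]
    simp
  · rw [AlgHom.comp_apply, stratumPow_X, stratumPoint_X, stratumPoint_X]

lemma exists_eq_stratumPoint (p : StratumRing k →ₐ[ℂ] ℂ) : ∃ c a, p = stratumPoint c a := by
  refine ⟨((isUnit_torusChar 1).map p).unit, fun j => p (MvPolynomial.X j),
    stratumRing_algHom_ext ?_ fun j => ?_⟩
  · rw [stratumPoint_torusChar]
    simp
  · rw [stratumPoint_X]

/-- The universal series `c tⁿ (1 + ∑ a_j t^{j+1})`. -/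
def universalSeries (k n : ℕ) : (StratumRing k)⟦X⟧ :=
  PowerSeries.C (torusChar k 1) * PowerSeries.X ^ n * unitSeries fun j => MvPolynomial.X j

lemma map_universalSeries (c : ℂˣ) (a : Fin k → ℂ) (n : ℕ) :
    PowerSeries.map (stratumPoint c a).toRingHom (universalSeries k n) =
      PowerSeries.C (c : ℂ) * PowerSeries.X ^ n * unitSeries a := by
  rw [universalSeries, map_mul, map_mul, map_unitSeries, map_pow, PowerSeries.map_X,
    PowerSeries.map_C]
  congr
  · have := stratumPoint_torusChar c a 1
    rw [zpow_one] at this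
    exact this
  · funext j
    exact stratumPoint_X c a j

variable {P : Type} [AddCommMonoid P]

lemma comp_jetHomFamily_universalSeries (δ : P →+ ℕ) (s n : ℕ) (c : ℂˣ) (a : Fin k → ℂ) :
    (stratumPoint c a).comp (jetHomFamily s (monomialArc δ (universalSeries k n))) =
      jetHom s (monomialArc δ (PowerSeries.C (c : ℂ) * PowerSeries.X ^ n * unitSeries a)) := by
  rw [comp_jetHomFamily, mapAlgHom_comp_monomialArc, map_universalSeries]

lemma exists_generator (U : Set ℤ) :
    ∃ g : ℕ, AddSubgroup.closure U = AddSubgroup.zmultiples (g : ℤ) := by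
  obtain ⟨a, ha⟩ := Int.subgroup_cyclic (AddSubgroup.closure U)
  exact ⟨a.natAbs, by rw [ha, Int.zmultiples_natAbs, AddSubgroup.zmultiples_eq_closure]⟩

/-- In $f^{\delta(u)}$ the parameter $c$ occurs only as $c^{\delta(u)}$, and modulo $t^{s+1}$ only
the $u$ with $n\delta(u) \le s$ matter. So the coordinates of the jet lie in the subring generated
by $c^{\pm g}$ and the $a_j$, which is the range of `stratumPow`. -/
lemma exists_factor (δ : P →+ ℕ) {s n g : ℕ} (hg0 : g ≠ 0)
    (hg : ∀ u, n * δ u ≤ s → g ∣ δ u) :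
    ∃ β : JetRing (AddMonoidAlgebra ℂ P) s →ₐ[ℂ] StratumRing k,
      (stratumPow k g).comp β = jetHomFamily s (monomialArc δ (universalSeries k n)) := by
  have hle : (jetHomFamily s (monomialArc δ (universalSeries k n))).range ≤
      (stratumPow k g).range := by
    refine jetRing_range_le _ _ fun f j => ?_
    rw [jetHomFamily_jetCoord]
    induction f using AddMonoidAlgebra.induction_on with
    | of u =>
      change PowerSeries.coeff (j : ℕ) (monomialArc δ _ (AddMonoidAlgebra.single u 1)) ∈ _
      rw [monomialArc_single, universalSeries, coeff_C_mul_X_pow_mul_pow]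
      split_ifs with h
      · refine Subalgebra.mul_mem _ ?_ (coeff_pow_mem _ (fun i => ?_) _ _)
        · obtain ⟨e, he⟩ := hg u (h.trans (Nat.le_of_lt_succ j.2))
          refine ⟨torusChar k e, ?_⟩
          change stratumPow k g _ = _
          rw [stratumPow_torusChar, torusChar_pow, he]
          push_cast
          ring_nf
        · rw [unitSeries, PowerSeries.coeff_mk]
          split_ifs with h1 h2
          · exact Subalgebra.one_mem _
          · exact ⟨MvPolynomial.X ⟨i - 1, h2⟩, stratumPow_X _ _⟩
          · exact Subalgebra.zero_mem _
      · exact Subalgebra.zero_mem _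
    | add x y hx hy =>
      rw [map_add, map_add]
      exact Subalgebra.add_mem _ hx hy
    | smul r x hx =>
      rw [map_smul, PowerSeries.coeff_smul]
      exact Subalgebra.smul_mem _ hx r
  choose b hb using fun x => hle ⟨x, rfl⟩
  have hinj := stratumPow_injective (k := k) hg0
  let α := jetHomFamily s (monomialArc δ (universalSeries k n))
  have hb' : ∀ x, stratumPow k g (b x) = α x := hb
  refine ⟨(AlgEquiv.ofInjective (stratumPow k g) hinj).symm.toAlgHom.comp
    ((Subalgebra.inclusion hle).comp α.rangeRestrict), ?_⟩
  ext x : 1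
  exact congrArg Subtype.val
    ((AlgEquiv.ofInjective (stratumPow k g) hinj).apply_symm_apply
      (Subalgebra.inclusion hle (α.rangeRestrict x)))

/-- By `isImmersion_specMap` it suffices that $\beta$ becomes surjective once one unit in its image
is inverted. That unit is the leading coefficient for $u_0$. The leading coefficients for all
visible $u$ then give every character, because the exponents $\delta(u)/g$ generate $\mathbf Z$, and
the higher coefficients for $u_0$ give the $a_j$. -/
lemma isImmersion_factor (δ : P →+ ℕ) {s n g : ℕ} (hg0 : g ≠ 0)
    (hg : AddSubgroup.closure {z : ℤ | ∃ u, n * δ u ≤ s ∧ z = δ u} = AddSubgroup.zmultiples (g : ℤ))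
    (u₀ : P) (hu₀ : δ u₀ ≠ 0) (hk : n * δ u₀ + k = s)
    (β : JetRing (AddMonoidAlgebra ℂ P) s →ₐ[ℂ] StratumRing k)
    (hβ : (stratumPow k g).comp β = jetHomFamily s (monomialArc δ (universalSeries k n))) :
    IsImmersion (specMap β).left := by
  have hinj := stratumPow_injective (k := k) hg0
  have hβ' : ∀ x, stratumPow k g (β x) = jetHomFamily s (monomialArc δ (universalSeries k n)) x :=
    fun x => congrArg (fun α => α x) hβ
  have hmono : ∀ (u : P) (i : ℕ) (hi : n * δ u + i < s + 1),
      stratumPow k g (β (jetCoord s (AddMonoidAlgebra.single u 1) ⟨n * δ u + i, hi⟩)) =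
        torusChar k (δ u) * PowerSeries.coeff i
          ((unitSeries fun j : Fin k => (MvPolynomial.X j : StratumRing k)) ^ δ u) := by
    intro u i hi
    rw [hβ', jetHomFamily_jetCoord, monomialArc_single, universalSeries, coeff_C_mul_X_pow_mul_pow,
      if_pos (Nat.le_add_right _ _), torusChar_pow, mul_one, Nat.add_sub_cancel_left]
  have hdvd : ∀ u, n * δ u ≤ s → ∃ e : ℤ, (δ u : ℤ) = e * g := by
    intro u hu
    have : (δ u : ℤ) ∈ AddSubgroup.zmultiples (g : ℤ) := by
      rw [← hg]
      exact AddSubgroup.subset_closure ⟨u, hu, rfl⟩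
    obtain ⟨e, he⟩ := AddSubgroup.mem_zmultiples_iff.mp this
    exact ⟨e, by simpa using he.symm⟩
  have hmono' : ∀ (u : P) (e : ℤ), (δ u : ℤ) = e * g → ∀ (i : ℕ) (hi : n * δ u + i < s + 1),
      β (jetCoord s (AddMonoidAlgebra.single u 1) ⟨n * δ u + i, hi⟩) =
        torusChar k e * PowerSeries.coeff i
          ((unitSeries fun j : Fin k => (MvPolynomial.X j : StratumRing k)) ^ δ u) := by
    intro u e he i hi
    apply hinj
    rw [hmono, map_mul, stratumPow_torusChar, ← he]
    congr 1
    refine Eq.trans ?_ (PowerSeries.coeff_map (stratumPow k g).toRingHom _ _)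
    refine congrArg (PowerSeries.coeff i) (Eq.symm ?_)
    rw [map_pow, map_unitSeries]
    refine congrArg (fun a => unitSeries a ^ δ u) ?_
    funext j
    exact stratumPow_X g j
  obtain ⟨m, hm⟩ := hdvd u₀ (by omega)
  let x : JetRing (AddMonoidAlgebra ℂ P) s :=
    jetCoord s (AddMonoidAlgebra.single u₀ 1) ⟨n * δ u₀ + 0, by omega⟩
  have hx : β x = torusChar k m := by
    rw [hmono' u₀ m hm]
    rw [coeff_zero_unitSeries_pow, mul_one]
  have hxu : IsUnit (β x) := hx ▸ isUnit_torusChar m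
  refine isImmersion_specMap β x hxu ?_
  -- The image of $\beta$ after inverting $\beta(x)$; the goal is that it is everything.
  let S : Subalgebra ℂ (StratumRing k) :=
    { carrier := {b | ∃ (N : ℕ) (a : _), β a = β x ^ N * b}
      mul_mem' := by
        rintro b b' ⟨N, a, ha⟩ ⟨N', a', ha'⟩
        exact ⟨N + N', a * a', by rw [map_mul, ha, ha', pow_add]; ring⟩
      add_mem' := by
        rintro b b' ⟨N, a, ha⟩ ⟨N', a', ha'⟩
        exact ⟨N + N', x ^ N' * a + x ^ N * a', by
          rw [map_add, map_mul, map_mul, map_pow, map_pow, ha, ha', pow_add]; ring⟩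
      algebraMap_mem' := fun c => ⟨0, algebraMap ℂ _ c, by simp⟩ }
  have hSβ : ∀ a, β a ∈ S := fun a => ⟨0, a, by simp⟩
  have hSm : torusChar k (-m) ∈ S :=
    ⟨1, 1, by rw [hx, map_one, pow_one, ← torusChar_add, add_neg_cancel, torusChar_zero]⟩
  have hSe : ∀ u, n * δ u ≤ s → ∀ e : ℤ, (δ u : ℤ) = e * g → torusChar k e ∈ S := by
    intro u hu e he
    have := hmono' u e he 0 (by omega)
    rw [coeff_zero_unitSeries_pow, mul_one] at this
    rw [← this]
    exact hSβ _
  -- Only $\beta(x) = y^m$ has been inverted, yet the other characters become invertible in $S$: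
  -- from $m\,\delta(u) = e\,\delta(u_0)$ one gets $y^{-e} =
  -- (y^{-m})^{\delta(u)}(y^e)^{\delta(u_0)-1}$.
  have hSe' : ∀ u, n * δ u ≤ s → ∀ e : ℤ, (δ u : ℤ) = e * g → torusChar k (-e) ∈ S := by
    intro u hu e he
    have hmul : (δ u : ℤ) * m = δ u₀ * e := by
      rw [hm, he]
      ring
    have h1 : torusChar k (-e) = torusChar k (-m) ^ δ u * torusChar k e ^ (δ u₀ - 1) := by
      rw [torusChar_pow, torusChar_pow, ← torusChar_add]
      congr 1
      rw [Nat.cast_sub (Nat.one_le_iff_ne_zero.mpr hu₀), mul_neg, hmul]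
      push_cast
      ring
    rw [h1]
    exact S.mul_mem (S.pow_mem hSm _) (S.pow_mem (hSe u hu e he) _)
  let H : AddSubgroup ℤ :=
    { carrier := {e | torusChar k e ∈ S ∧ torusChar k (-e) ∈ S}
      zero_mem' := by
        simp only [Set.mem_ofPred_eq, neg_zero, torusChar_zero, and_self]
        exact S.one_mem
      add_mem' := by
        rintro e e' ⟨h1, h2⟩ ⟨h3, h4⟩
        refine ⟨?_, ?_⟩
        · rw [torusChar_add]
          exact S.mul_mem h1 h3
        · rw [neg_add, torusChar_add]
          exact S.mul_mem h2 h4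
      neg_mem' := by
        rintro e ⟨h1, h2⟩
        exact ⟨h2, by rwa [neg_neg]⟩ }
  -- $gH$ contains every visible $\delta(u)$, hence the generator $g$ of the group they span.
  have hH1 : (1 : ℤ) ∈ H := by
    have hle : AddSubgroup.closure {z : ℤ | ∃ u, n * δ u ≤ s ∧ z = δ u} ≤
        H.map (AddMonoidHom.mulRight (g : ℤ)) := by
      rw [AddSubgroup.closure_le]
      rintro _ ⟨u, hu, rfl⟩
      obtain ⟨e, he⟩ := hdvd u hu
      exact ⟨e, ⟨hSe u hu e he, hSe' u hu e he⟩, he.symm⟩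
    rw [hg] at hle
    obtain ⟨e, he, heg⟩ := hle (AddSubgroup.mem_zmultiples (g : ℤ))
    have heg' : e * (g : ℤ) = g := heg
    have : e = 1 := by
      have hg' : (g : ℤ) ≠ 0 := Nat.cast_ne_zero.mpr hg0
      exact mul_right_cancel₀ hg' (by rw [heg', one_mul])
    rwa [this] at he
  have hST : ∀ i, torusChar k i ∈ S := fun i => by
    have : i ∈ H := by
      have := H.zsmul_mem hH1 i
      rwa [smul_eq_mul, mul_one] at this
    exact this.1
  have hSX : ∀ j : Fin k, MvPolynomial.X j ∈ S := by
    have := coeff_mem_of_coeff_pow_mem S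
      (w := unitSeries fun j : Fin k => (MvPolynomial.X j : StratumRing k))
      (coeff_unitSeries_zero _) hu₀ (k := k) fun i hi => by
        have h1 := hmono' u₀ m hm i (by omega)
        have h2 := S.mul_mem hSm (hSβ
          (jetCoord s (AddMonoidAlgebra.single u₀ 1) ⟨n * δ u₀ + i, by omega⟩))
        rw [h1, ← mul_assoc, ← torusChar_add, neg_add_cancel, torusChar_zero, one_mul] at h2
        exact h2
    intro j
    have h := this (j + 1) (by omega)
    rwa [coeff_unitSeries_succ] at h
  have hS := stratumRing_subalgebra_eq_top S hST hSX
  intro b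
  have : b ∈ S := hS ▸ Algebra.mem_top
  exact this

/-- The `s`-jets of the monomial arcs `X^u ↦ f^{δ(u)}` with `f` of order `n` form a locally
closed subvariety isomorphic to `𝔾ₘ × 𝔸^{s - nm}`, where `m` is the least positive value of `δ`. -/
theorem exists_stratum (δ : P →+ ℕ) (u₀ : P) (hu₀ : δ u₀ ≠ 0) (hmin : ∀ u, δ u ≠ 0 → δ u₀ ≤ δ u)
    (n s : ℕ) (hn : n * δ u₀ ≤ s) :
    ∃ (A : CVariety) (f : A.toOver ⟶ jetSpace (AddMonoidAlgebra ℂ P) s),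
      IsImmersion f.left ∧
      (Set.range fun p : CPoints A.toOver => p ≫ f) =
        {j | ∃ (c : ℂ) (v : ℂ⟦X⟧), c ≠ 0 ∧ PowerSeries.coeff 0 v = 1 ∧
          j = jet s (monomialArc δ (PowerSeries.C c * PowerSeries.X ^ n * v))} ∧
      varClass A = (lefschetz - 1) * lefschetz ^ (s - n * δ u₀) := by
  obtain ⟨k, hk⟩ := Nat.exists_eq_add_of_le hn
  obtain ⟨g, hg⟩ := exists_generator {z : ℤ | ∃ u, n * δ u ≤ s ∧ z = δ u}
  have hdvd : ∀ u, n * δ u ≤ s → g ∣ δ u := by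
    intro u hu
    have : (δ u : ℤ) ∈ AddSubgroup.zmultiples (g : ℤ) := by
      rw [← hg]
      exact AddSubgroup.subset_closure ⟨u, hu, rfl⟩
    exact Int.natCast_dvd_natCast.mp (Int.mem_zmultiples_iff.mp this)
  have hg0 : g ≠ 0 := by
    rintro rfl
    exact hu₀ (zero_dvd_iff.mp (hdvd u₀ hn))
  obtain ⟨β, hβ⟩ := exists_factor (k := k) δ hg0 hdvd
  refine ⟨CVariety.ofAlgebra (StratumRing k), specMap β,
    isImmersion_factor δ hg0 hg u₀ hu₀ hk.symm β hβ, ?_, ?_⟩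
  · refine (range_cpoint_comp β).trans (Set.ext fun q => ⟨?_, ?_⟩)
    · rintro ⟨p, rfl⟩
      obtain ⟨y, a, rfl⟩ := exists_eq_stratumPoint p
      -- The coordinate $y$ on the stratum is $c^g$; a $g$-th root is needed to realize the point by
      -- an actual arc.
      obtain ⟨c, hc⟩ := IsAlgClosed.exists_pow_nat_eq (y : ℂ) (Nat.pos_of_ne_zero hg0)
      have hc0 : c ≠ 0 := by
        rintro rfl
        rw [zero_pow hg0] at hc
        exact y.ne_zero hc.symm
      refine ⟨c, unitSeries a, hc0, coeff_unitSeries_zero a, ?_⟩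
      have hy : y = Units.mk0 c hc0 ^ g := Units.ext (by simp [hc])
      dsimp only
      rw [hy, ← stratumPoint_comp_stratumPow, AlgHom.comp_assoc, hβ,
        comp_jetHomFamily_universalSeries]
      rfl
    · rintro ⟨c, v, hc, hv, rfl⟩
      let a : Fin k → ℂ := fun j => PowerSeries.coeff (j + 1 : ℕ) v
      refine ⟨(stratumPoint (Units.mk0 c hc) a).comp (stratumPow k g), ?_⟩
      dsimp only
      rw [AlgHom.comp_assoc, hβ, comp_jetHomFamily_universalSeries, ← jet_eq_cpoint,
        jet_eq_jet_iff_single]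
      intro u j hj
      rw [monomialArc_single, monomialArc_single, coeff_C_mul_X_pow_mul_pow,
        coeff_C_mul_X_pow_mul_pow, Units.val_mk0]
      split_ifs with h
      · by_cases hu : δ u = 0
        · rw [hu]
          simp
        · congr 1
          -- Minimality of $\delta(u_0)$ gives $j - n\delta(u) \le s - n\delta(u_0) = k$, so only
          -- the coefficients of $v$ retained in $a$ enter.
          have hle := Nat.mul_le_mul_left n (hmin u hu)
          refine coeff_pow_eq_of_coeff_eq (k := k) (fun i hi => ?_) _ _ (by omega)
          rcases i with _ | i
          · rw [coeff_unitSeries_zero, hv]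
          · exact coeff_unitSeries_succ a ⟨i, by omega⟩
      · rfl
  · rw [varClass_stratumRing, hk, Nat.add_sub_cancel_left]

end Strata

/-! ### The generating series -/

lemma mk_sum_Icc_eq {K : Type*} [CommRing K] (L : K) {m : ℕ} (hm : 0 < m) :
    (PowerSeries.mk fun s => ∑ n ∈ Finset.Icc 1 (s / m), (L - 1) * L ^ (s - n * m)) =
      PowerSeries.C (L - 1) * PowerSeries.X ^ m *
        PowerSeries.invOfUnit (1 - PowerSeries.C L * PowerSeries.X) 1 *
        PowerSeries.invOfUnit (1 - PowerSeries.X ^ m) 1 := by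
  set F : K⟦X⟧ := PowerSeries.mk fun s => ∑ n ∈ Finset.Icc 1 (s / m), (L - 1) * L ^ (s - n * m)
  set G : K⟦X⟧ := PowerSeries.mk fun s => L ^ s with hG
  have h1 : (1 - PowerSeries.C L * PowerSeries.X) *
      PowerSeries.invOfUnit (1 - PowerSeries.C L * PowerSeries.X) 1 = 1 :=
    PowerSeries.mul_invOfUnit _ _ (by simp)
  have h2 : (1 - PowerSeries.X ^ m : K⟦X⟧) * PowerSeries.invOfUnit (1 - PowerSeries.X ^ m) 1 = 1 :=
    PowerSeries.mul_invOfUnit _ _ (by simp [hm.ne'])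
  have h3 : G * (1 - PowerSeries.C L * PowerSeries.X) = 1 := by
    ext s
    rw [mul_sub, mul_one, map_sub, ← mul_assoc, mul_comm G]
    rcases s with _ | s
    · simp [hG]
    · rw [PowerSeries.coeff_succ_mul_X, PowerSeries.coeff_C_mul, hG, PowerSeries.coeff_mk,
        PowerSeries.coeff_mk, PowerSeries.coeff_one, if_neg (Nat.succ_ne_zero s), pow_succ',
        sub_self]
  -- Multiplication by $T^m$ shifts the summation index $n$ by one, so that only the term $n = 1$
  -- survives in the difference.
  have h4 : F * (1 - PowerSeries.X ^ m) = PowerSeries.C (L - 1) * PowerSeries.X ^ m * G := by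
    ext s
    rw [mul_sub, mul_one, map_sub, mul_comm F, mul_assoc, PowerSeries.coeff_C_mul,
      PowerSeries.coeff_X_pow_mul', PowerSeries.coeff_X_pow_mul', PowerSeries.coeff_mk]
    split_ifs with h
    · rw [PowerSeries.coeff_mk, PowerSeries.coeff_mk, Nat.div_eq_sub_div hm h,
        ← Finset.add_sum_Ioc_eq_sum_Icc (Nat.le_add_left 1 _), one_mul]
      have : ∑ n ∈ Finset.Ioc 1 ((s - m) / m + 1), (L - 1) * L ^ (s - n * m) =
          ∑ n ∈ Finset.Icc 1 ((s - m) / m), (L - 1) * L ^ (s - m - n * m) := by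
        symm
        refine Finset.sum_bij (fun n _ => n + 1) ?_ ?_ ?_ ?_
        · intro n hn
          simp only [Finset.mem_Icc, Finset.mem_Ioc] at hn ⊢
          omega
        · intro a _ b _ hab
          exact Nat.succ_injective hab
        · intro n hn
          simp only [Finset.mem_Ioc] at hn
          exact ⟨n - 1, by simp only [Finset.mem_Icc]; omega, by omega⟩
        · intro n _
          rw [Nat.sub_sub, add_mul, one_mul, add_comm m]
      rw [this, add_sub_cancel_right]
    · rw [Nat.div_eq_of_lt (by omega)]
      simp
  have h5 : PowerSeries.invOfUnit (1 - PowerSeries.C L * PowerSeries.X) 1 = G :=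
    (left_inv_eq_right_inv h3 h1).symm
  rw [h5, ← h4, mul_assoc, h2, mul_one]

/-! ### Multiplicity of a monomial curve -/

section Multiplicity

/-- A polynomial of positive degree is unbounded on the natural numbers, so $p - mX$ is constant. -/
lemma natDegree_and_leadingCoeff_of_eventually_abs_sub_le {p : ℚ[X]} {m : ℕ} (hm : 0 < m) (c : ℚ)
    (h : ∀ᶠ n : ℕ in Filter.atTop, |p.eval (n : ℚ) - m * n| ≤ c) :
    p.natDegree = 1 ∧ p.leadingCoeff = m := by
  set q : ℚ[X] := p - Polynomial.C (m : ℚ) * Polynomial.X with hq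
  have hqe : ∀ n : ℕ, q.eval (n : ℚ) = p.eval (n : ℚ) - m * n := fun n => by simp [hq]
  have hdeg : q.degree ≤ 0 := by
    by_contra hdeg
    have ht := (q.abs_tendsto_atTop (not_le.mp hdeg)).comp (tendsto_natCast_atTop_atTop (R := ℚ))
    obtain ⟨n, hn, hn'⟩ := (h.and (ht.eventually_gt_atTop c)).exists
    rw [Function.comp_apply, hqe] at hn'
    exact absurd hn (not_le.mpr hn')
  have hp : p = Polynomial.C (m : ℚ) * Polynomial.X + Polynomial.C (q.coeff 0) := by
    rw [← Polynomial.eq_C_of_degree_le_zero hdeg, hq]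
    ring
  have hm' : (m : ℚ) ≠ 0 := Nat.cast_ne_zero.mpr hm.ne'
  rw [hp]
  exact ⟨Polynomial.natDegree_linear hm', Polynomial.leadingCoeff_linear hm'⟩

variable {P : Type} [AddCommMonoid P]

/-- The ideal generated by the nontrivial monomials. -/
def monomialIdeal (P : Type) [AddCommMonoid P] : Ideal (AddMonoidAlgebra ℂ P) :=
  Ideal.span {x | ∃ u : P, u ≠ 0 ∧ x = AddMonoidAlgebra.single u 1}

/-- The ideal of functions of weight at least `b`. -/
def weightIdeal (δ : P →+ ℕ) (b : ℕ) : Ideal (AddMonoidAlgebra ℂ P) :=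
  (Ideal.span {PowerSeries.X ^ b}).comap (monomialArc δ (PowerSeries.X : ℂ⟦X⟧)).toRingHom

lemma mem_weightIdeal (δ : P →+ ℕ) (b : ℕ) (f : AddMonoidAlgebra ℂ P) :
    f ∈ weightIdeal δ b ↔ PowerSeries.X ^ b ∣ monomialArc δ (PowerSeries.X : ℂ⟦X⟧) f :=
  Ideal.mem_comap.trans Ideal.mem_span_singleton

lemma single_mem_weightIdeal (δ : P →+ ℕ) (b : ℕ) (u : P) :
    AddMonoidAlgebra.single u 1 ∈ weightIdeal δ b ↔ b ≤ δ u := by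
  rw [mem_weightIdeal, monomialArc_single]
  exact pow_dvd_pow_iff PowerSeries.X_ne_zero PowerSeries.X_prime.not_isUnit

lemma length_quotient_add_one_le {R : Type*} [CommRing R] {I J : Ideal R} (h : I < J) :
    Module.length R (R ⧸ J) + 1 ≤ Module.length R (R ⧸ I) := by
  let f : (R ⧸ I) →ₗ[R] (R ⧸ J) := Submodule.factor h.le
  have hf : Function.Surjective f := Submodule.factor_surjective h.le
  have hne : Nontrivial (LinearMap.ker f) := by
    obtain ⟨x, hxJ, hxI⟩ := SetLike.exists_of_lt h
    refine ⟨⟨⟨Submodule.Quotient.mk x, ?_⟩, 0, fun e => hxI ?_⟩⟩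
    · rw [LinearMap.mem_ker]
      exact (Submodule.Quotient.mk_eq_zero J).mpr hxJ
    · exact (Submodule.Quotient.mk_eq_zero I).mp (congrArg Subtype.val e)
  have := Module.length_eq_add_of_exact (LinearMap.ker f).subtype f (Submodule.injective_subtype _)
    hf (LinearMap.exact_subtype_ker_map f)
  rw [this, add_comm]
  gcongr
  exact Order.one_le_iff_pos.mpr Module.length_pos

lemma weightIdeal_succ_lt (δ : P →+ ℕ) (u : P) : weightIdeal δ (δ u + 1) < weightIdeal δ (δ u) := by
  refine lt_of_le_of_ne (fun f hf => ?_) fun h => ?_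
  · rw [mem_weightIdeal] at hf ⊢
    exact (pow_dvd_pow _ (Nat.le_succ _)).trans hf
  · have := (single_mem_weightIdeal δ (δ u) u).mpr le_rfl
    rw [← h, single_mem_weightIdeal] at this
    omega

/-- Beyond the conductor every weight is attained by a monomial, so the filtration by weight drops
strictly at each step. -/
lemma le_length_quotient_weightIdeal (δ : P →+ ℕ) {c : ℕ} (hc : ∀ i, c ≤ i → ∃ u, δ u = i)
    (i : ℕ) :
    (i : ℕ∞) ≤ Module.length (AddMonoidAlgebra ℂ P)
      (AddMonoidAlgebra ℂ P ⧸ weightIdeal δ (c + i)) := by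
  induction i with
  | zero => simp
  | succ i ih =>
    obtain ⟨u, hu⟩ := hc (c + i) (Nat.le_add_right _ _)
    have := length_quotient_add_one_le (weightIdeal_succ_lt δ u)
    rw [hu] at this
    rw [Nat.cast_succ]
    exact (add_le_add_left ih 1).trans this

lemma monomialIdeal_pow_le (δ : P →+ ℕ) (hinj : Function.Injective δ) {m : ℕ}
    (hmin : ∀ u, δ u ≠ 0 → m ≤ δ u) (n : ℕ) :
    monomialIdeal P ^ n ≤ weightIdeal δ (n * m) := by
  have h1 : monomialIdeal P ≤ weightIdeal δ m := by
    refine Ideal.span_le.mpr ?_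
    rintro _ ⟨u, hu, rfl⟩
    refine (single_mem_weightIdeal δ m u).mpr (hmin u fun h => hu (hinj ?_))
    rw [h, map_zero]
  refine (Ideal.pow_right_mono h1 n).trans ((Ideal.le_comap_pow _ n).trans ?_)
  rw [Ideal.span_singleton_pow, ← pow_mul, mul_comm]
  rfl

/-- Split $u = n u_0 + v$. The remaining weight is at least $c > 0$, so $v$ exists and is nonzero,
supplying the $(n+1)$-st factor. -/
lemma single_mem_monomialIdeal_pow (δ : P →+ ℕ) (hinj : Function.Injective δ) {u₀ : P}
    (hu₀ : u₀ ≠ 0) {c : ℕ} (hc0 : 0 < c) (hc : ∀ i, c ≤ i → ∃ u, δ u = i) (n : ℕ) (u : P)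
    (hu : n * δ u₀ + c ≤ δ u) : AddMonoidAlgebra.single u 1 ∈ monomialIdeal P ^ (n + 1) := by
  obtain ⟨v, hv⟩ := hc (δ u - n * δ u₀) (by omega)
  have huv : u = n • u₀ + v := hinj (by rw [map_add, map_nsmul, hv, smul_eq_mul]; omega)
  have hv0 : v ≠ 0 := by
    rintro rfl
    rw [map_zero] at hv
    omega
  have : (AddMonoidAlgebra.single u 1 : AddMonoidAlgebra ℂ P) =
      AddMonoidAlgebra.single u₀ 1 ^ n * AddMonoidAlgebra.single v 1 := by
    rw [AddMonoidAlgebra.single_pow, AddMonoidAlgebra.single_mul_single, huv, one_pow, one_mul]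
  have hI : ∀ w : P, w ≠ 0 → AddMonoidAlgebra.single w 1 ∈ monomialIdeal P :=
    fun w hw => Ideal.subset_span ⟨w, hw, rfl⟩
  rw [this, pow_succ]
  exact Ideal.mul_mem_mul (Ideal.pow_mem_pow (hI u₀ hu₀) n) (hI v hv0)

/-- The length is at most the dimension over $\mathbf C$, and the monomials of weight below $N$, at
most one for each weight, span the quotient. -/
lemma length_quotient_le (δ : P →+ ℕ) (hinj : Function.Injective δ)
    (I : Ideal (AddMonoidAlgebra ℂ P)) {N : ℕ}
    (h : ∀ u, N ≤ δ u → AddMonoidAlgebra.single u 1 ∈ I) :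
    Module.length (AddMonoidAlgebra ℂ P) (AddMonoidAlgebra ℂ P ⧸ I) ≤ N := by
  classical
  let v : Fin N → AddMonoidAlgebra ℂ P ⧸ I := fun i =>
    if h : ∃ u, δ u = i then Ideal.Quotient.mk I (AddMonoidAlgebra.single h.choose 1) else 0
  have hv : ∀ u, Ideal.Quotient.mk I (AddMonoidAlgebra.single u 1) ∈
      LinearMap.range (Fintype.linearCombination ℂ v) := by
    intro u
    by_cases hu : N ≤ δ u
    · rw [Ideal.Quotient.eq_zero_iff_mem.mpr (h u hu)]
      exact zero_mem _
    · let i : Fin N := ⟨δ u, by omega⟩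
      have hi : ∃ w, δ w = i := ⟨u, rfl⟩
      refine ⟨Pi.single i 1, ?_⟩
      rw [Fintype.linearCombination_apply_single, one_smul]
      have : hi.choose = u := hinj hi.choose_spec
      simp only [v]
      rw [dif_pos hi, this]
  have hsurj : Function.Surjective (Fintype.linearCombination ℂ v) := by
    intro x
    obtain ⟨f, rfl⟩ := Ideal.Quotient.mk_surjective x
    change _ ∈ LinearMap.range (Fintype.linearCombination ℂ v)
    induction f using AddMonoidAlgebra.induction_on with
    | of u => exact hv u
    | add x y hx hy =>
      rw [map_add]
      exact add_mem hx hy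
    | smul r x hx => exact Submodule.smul_mem _ r hx
  have h1 := Submodule.length_le_length_restrictScalars ℂ
    (⊤ : Submodule (AddMonoidAlgebra ℂ P) (AddMonoidAlgebra ℂ P ⧸ I))
  rw [Submodule.restrictScalars_top, Module.length_top, Module.length_top] at h1
  refine h1.trans ((Module.length_le_of_surjective (Fintype.linearCombination ℂ v) hsurj).trans ?_)
  rw [Module.length_eq_finrank]
  simp

theorem HasMultiplicity.eq_of_monomialIdeal (δ : P →+ ℕ) (hinj : Function.Injective δ) {u₀ : P}
    (hu₀ : δ u₀ ≠ 0) (hmin : ∀ u, δ u ≠ 0 → δ u₀ ≤ δ u) {c : ℕ}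
    (hc : ∀ i, c ≤ i → ∃ u, δ u = i) {m : ℕ} (hm : HasMultiplicity (monomialIdeal P) m) :
    m = δ u₀ := by
  obtain ⟨p, hp, hmp⟩ := hm
  have hu₀' : u₀ ≠ 0 := by
    rintro rfl
    exact hu₀ (map_zero δ)
  obtain ⟨h1, h2⟩ := natDegree_and_leadingCoeff_of_eventually_abs_sub_le (p := p)
    (Nat.pos_of_ne_zero hu₀)
    ((c : ℚ) + 1) (by
      filter_upwards [hp, Filter.eventually_ge_atTop (c + 1)] with n hn hnc
      obtain ⟨l, hl, hlp⟩ := hn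
      have hδ := Nat.pos_of_ne_zero hu₀
      have hnm : n ≤ n * δ u₀ := Nat.le_mul_of_pos_right n hδ
      -- Membership in the $n$-th power uses $n-1$ copies of $u_0$ and one further factor; $c+1$ in
      -- place of $c$ keeps that factor nontrivial even when $c = 0$.
      have upper : l ≤ (n - 1) * δ u₀ + (c + 1) := by
        have := length_quotient_le δ hinj (monomialIdeal P ^ n) (N := (n - 1) * δ u₀ + (c + 1))
          fun u hu => by
            have := single_mem_monomialIdeal_pow δ hinj hu₀' (c := c + 1) (by omega)
              (fun i hi => hc i (by omega)) (n - 1) u hu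
            rwa [Nat.sub_add_cancel (by omega)] at this
        rw [hl] at this
        exact_mod_cast this
      have lower : n * δ u₀ - c ≤ l := by
        have h := le_length_quotient_weightIdeal δ hc (n * δ u₀ - c)
        rw [Nat.add_sub_cancel' (by omega)] at h
        have := h.trans (Module.length_le_of_surjective _
          (Submodule.factor_surjective (monomialIdeal_pow_le δ hinj hmin n)))
        rw [hl] at this
        exact_mod_cast this
      have hupper : l ≤ n * δ u₀ + (c + 1) :=
        upper.trans (Nat.add_le_add_right (Nat.mul_le_mul_right _ (Nat.sub_le _ _)) _)
      have hlower : n * δ u₀ ≤ l + c := by omega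
      have hupper' : (l : ℚ) ≤ n * δ u₀ + (c + 1) := by exact_mod_cast hupper
      have hlower' : (n : ℚ) * δ u₀ ≤ l + c := by exact_mod_cast hlower
      rw [← hlp, abs_le]
      constructor <;> linarith)
  rw [h1, h2] at hmp
  simpa using hmp

end Multiplicity

/-! ### Rank one semigroups -/

section RankOne

open scoped TensorProduct

variable {M : Type} [AddCommGroup M]

/-- The linear form on `M_ℝ` which extends a coordinate on `M`. -/
def realCoord (e : M ≃+ ℤ) : (ℝ ⊗[ℤ] M) ≃ₗ[ℝ] ℝ :=
  (LinearEquiv.baseChange ℤ ℝ M ℤ e.toIntLinearEquiv).trans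
    (TensorProduct.AlgebraTensorModule.rid ℤ ℝ ℝ)

lemma realCoord_tmul (e : M ≃+ ℤ) (u : M) : realCoord e (1 ⊗ₜ[ℤ] u) = e u := by
  simp [realCoord]

lemma eq_smul_tmul (e : M ≃+ ℤ) {u : M} (hu : u ≠ 0) (x : ℝ ⊗[ℤ] M) :
    x = (realCoord e x / e u) • (1 : ℝ) ⊗ₜ[ℤ] u := by
  have h : (e u : ℝ) ≠ 0 := by
    rw [Int.cast_ne_zero]
    exact fun h => hu (e.injective (by rw [h, map_zero]))
  apply (realCoord e).injective
  rw [map_smul, realCoord_tmul, smul_eq_mul, div_mul_cancel₀ _ h]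

lemma tmul_mem_realCone (Λ : AddSubmonoid M) {u : M} (hu : u ∈ Λ) :
    (1 : ℝ) ⊗ₜ[ℤ] u ∈ realCone Λ := Submodule.subset_span ⟨u, hu, rfl⟩

/-- On the line $M_{\mathbf R}$ the vector $-(1 \otimes u)$ is a nonnegative multiple of $1 \otimes
v$, so the cone would contain a nonzero vector and its opposite. -/
lemma not_pos_and_neg_of_salient (Λ : AddSubmonoid M)
    (hconvex : (realCone Λ : ConvexCone ℝ (ℝ ⊗[ℤ] M)).Salient) (e : M ≃+ ℤ) {u v : M}
    (hu : u ∈ Λ) (hv : v ∈ Λ) (heu : 0 < e u) (hev : e v < 0) : False := by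
  have hu0 : (1 : ℝ) ⊗ₜ[ℤ] u ≠ 0 := by
    intro h
    have := congrArg (realCoord e) h
    rw [realCoord_tmul, map_zero, Int.cast_eq_zero] at this
    omega
  refine hconvex _ (tmul_mem_realCone Λ hu) hu0 ?_
  have hv0 : v ≠ 0 := by
    rintro rfl
    rw [map_zero] at hev
    omega
  rw [eq_smul_tmul e hv0 (-((1 : ℝ) ⊗ₜ[ℤ] u))]
  have hc : 0 ≤ realCoord e (-((1 : ℝ) ⊗ₜ[ℤ] u)) / e v := by
    rw [map_neg, realCoord_tmul]
    have h1 : (0 : ℝ) < e u := by exact_mod_cast heu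
    have h2 : (e v : ℝ) < 0 := by exact_mod_cast hev
    exact div_nonneg_of_nonpos (by linarith) h2.le
  exact (realCone Λ).smul_mem hc (tmul_mem_realCone Λ hv)

/-- A coordinate on `M` which is nonnegative on a strictly convex semigroup of rank one. -/
lemma exists_coord [Module.Free ℤ M] [Module.Finite ℤ M] (hrank : Module.finrank ℤ M = 1)
    (Λ : AddSubmonoid M) (hconvex : (realCone Λ : ConvexCone ℝ (ℝ ⊗[ℤ] M)).Salient) :
    ∃ e : M ≃+ ℤ, ∀ u ∈ Λ, 0 ≤ e u := by
  let e : M ≃+ ℤ := ((Module.finBasisOfFinrankEq ℤ M hrank).equivFun.trans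
    (LinearEquiv.funUnique (Fin 1) ℤ ℤ)).toAddEquiv
  by_cases h : ∃ u ∈ Λ, 0 < e u
  · obtain ⟨u, hu, hu'⟩ := h
    exact ⟨e, fun v hv => not_lt.mp fun hv' =>
      not_pos_and_neg_of_salient Λ hconvex e hu hv hu' hv'⟩
  · refine ⟨e.trans (AddEquiv.neg ℤ), fun u hu => ?_⟩
    have := not_lt.mp fun hu' => h ⟨u, hu, hu'⟩
    simpa using this

variable (Λ : AddSubmonoid M) (e : M ≃+ ℤ) (he : ∀ u ∈ Λ, 0 ≤ e u)

/-- The weight function on a semigroup of nonnegative elements. -/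
def weight : Λ →+ ℕ where
  toFun u := (e u).toNat
  map_zero' := by simp
  map_add' u v := by
    have hu := he u u.2
    have hv := he v v.2
    rw [AddSubmonoid.coe_add, map_add]
    omega

lemma weight_cast (u : Λ) : (weight Λ e he u : ℤ) = e u := Int.toNat_of_nonneg (he u u.2)

lemma weight_injective : Function.Injective (weight Λ e he) := fun u v h =>
  Subtype.ext (e.injective (by rw [← weight_cast Λ e he, ← weight_cast Λ e he, h]))

/-- Every element of the group generated by a commutative semigroup is a difference of two semigroup
elements; apply this to the element with coordinate $1$. -/
lemma exists_weight_eq_add_one (hgen : AddSubgroup.closure (Λ : Set M) = ⊤) :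
    ∃ u v : Λ, weight Λ e he u = weight Λ e he v + 1 := by
  have key : ∀ x : M, ∃ u v : Λ, x = u - v := fun x => by
    have hx : x ∈ AddSubgroup.closure (Λ : Set M) := hgen ▸ AddSubgroup.mem_top x
    induction hx using AddSubgroup.closure_induction with
    | mem x hx => exact ⟨⟨x, hx⟩, 0, by simp⟩
    | zero => exact ⟨0, 0, by simp⟩
    | add x y _ _ hx hy =>
      obtain ⟨u, v, rfl⟩ := hx
      obtain ⟨u', v', rfl⟩ := hy
      exact ⟨u + u', v + v', by push_cast; abel⟩
    | neg x _ hx =>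
      obtain ⟨u, v, rfl⟩ := hx
      exact ⟨v, u, by abel⟩
  obtain ⟨u, v, h⟩ := key (e.symm 1)
  refine ⟨u, v, ?_⟩
  have := congrArg e h
  rw [AddEquiv.apply_symm_apply, map_sub, ← weight_cast Λ e he, ← weight_cast Λ e he] at this
  omega

/-- An additive map to `ℕ` taking two consecutive values takes all large values. -/
lemma exists_conductor {P : Type*} [AddCommMonoid P] (δ : P →+ ℕ) {u v : P}
    (h : δ u = δ v + 1) : ∃ c, ∀ i, c ≤ i → ∃ w, δ w = i := by
  -- With $d = \delta(v)$ and $i = qd + r$, $r < d$, one has $i = (q-r)d + r(d+1)$; the bound $i \ge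
  -- d^2$ ensures $q \ge d > r$ when $d > 0$.
  refine ⟨δ v * δ v, fun i hi => ?_⟩
  rcases Nat.eq_zero_or_pos (δ v) with hv | hv
  · exact ⟨i • u, by rw [map_nsmul, h, hv, smul_eq_mul, zero_add, mul_one]⟩
  · have hr := Nat.mod_lt i hv
    have hq : δ v ≤ i / δ v := (Nat.le_div_iff_mul_le hv).mpr hi
    refine ⟨(i / δ v - i % δ v) • v + (i % δ v) • u, ?_⟩
    rw [map_add, map_nsmul, map_nsmul, h, smul_eq_mul, smul_eq_mul, mul_add, mul_one, ← add_assoc,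
      ← add_mul, Nat.sub_add_cancel (by omega), mul_comm]
    exact Nat.div_add_mod i (δ v)

end RankOne

/-! ### Arcs of a monomial curve -/

section Arcs

variable {M : Type} [AddCommGroup M] (Λ : AddSubmonoid M) (e : M ≃+ ℤ) (he : ∀ u ∈ Λ, 0 ≤ e u)

lemma exists_eq_algebraMap_add {P : Type} [AddCommMonoid P] (f : AddMonoidAlgebra ℂ P) :
    ∃ (a : ℂ) (g : _), g ∈ monomialIdeal P ∧ f = algebraMap ℂ _ a + g := by
  induction f using AddMonoidAlgebra.induction_on with
  | of u =>
    by_cases hu : u = 0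
    · subst hu
      exact ⟨1, 0, zero_mem _, by rw [map_one, add_zero]; rfl⟩
    · exact ⟨0, _, Ideal.subset_span ⟨u, hu, rfl⟩, by rw [map_zero, zero_add]; rfl⟩
  | add x y hx hy =>
    obtain ⟨a, g, hg, rfl⟩ := hx
    obtain ⟨b, g', hg', rfl⟩ := hy
    exact ⟨a + b, g + g', add_mem hg hg', by rw [map_add]; ring⟩
  | smul r x hx =>
    obtain ⟨a, g, hg, rfl⟩ := hx
    refine ⟨r * a, r • g, Submodule.smul_of_tower_mem _ r hg, ?_⟩
    rw [smul_add, map_mul, Algebra.smul_def r (algebraMap ℂ _ a)]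

lemma mem_maximalIdeal_iff (f : ℂ⟦X⟧) :
    f ∈ IsLocalRing.maximalIdeal ℂ⟦X⟧ ↔ PowerSeries.coeff 0 f = 0 := by
  rw [PowerSeries.maximalIdeal_eq_span_X, Ideal.mem_span_singleton, PowerSeries.X_dvd_iff,
    PowerSeries.coeff_zero_eq_constantCoeff_apply]

lemma weight_ne_zero {u : Λ} (hu : u ≠ 0) : weight Λ e he u ≠ 0 := fun h =>
  hu (weight_injective Λ e he (by rw [h, map_zero]))

lemma monomialArc_mem_arcsAtOrigin {f : ℂ⟦X⟧} (hf : PowerSeries.coeff 0 f = 0) :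
    monomialArc (weight Λ e he) f ∈ arcsAtOrigin Λ := by
  have hle : originIdeal Λ ≤ Ideal.comap (monomialArc (weight Λ e he) f).toRingHom
      (IsLocalRing.maximalIdeal ℂ⟦X⟧) := by
    refine Ideal.span_le.mpr ?_
    rintro _ ⟨u, hu, rfl⟩
    change monomialArc (weight Λ e he) f (monom u) ∈ IsLocalRing.maximalIdeal ℂ⟦X⟧
    rw [monomialArc_single]
    exact Ideal.pow_mem_of_mem _ ((mem_maximalIdeal_iff f).mpr hf) _
      (Nat.pos_of_ne_zero (weight_ne_zero Λ e he hu))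
  refine le_antisymm (fun g hg => ?_) hle
  obtain ⟨a, g, hg', rfl⟩ := exists_eq_algebraMap_add g
  have h1 : monomialArc (weight Λ e he) f (algebraMap ℂ _ a + g) ∈
    IsLocalRing.maximalIdeal ℂ⟦X⟧ := hg
  rw [map_add, Ideal.add_mem_iff_left _ (show monomialArc (weight Λ e he) f g ∈ _ from hle hg'),
    AlgHom.commutes, mem_maximalIdeal_iff] at h1
  have ha : a = 0 := by simpa [PowerSeries.algebraMap_apply] using h1
  rw [ha, map_zero, zero_add]
  exact hg'

lemma coeff_zero_of_mem_arcsAtOrigin {h : Arc (CoordRing Λ)} (hh : h ∈ arcsAtOrigin Λ) {u : Λ}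
    (hu : u ≠ 0) : PowerSeries.coeff 0 (h (monom u)) = 0 := by
  have h1 : monom u ∈ originIdeal Λ := Ideal.subset_span ⟨u, hu, rfl⟩
  rw [← hh] at h1
  exact (mem_maximalIdeal_iff _).mp h1

/-- Over the fraction field $f$ is invertible, so the arc extends to $\mathbf C[M]$ by $X^u \mapsto
f^{e(u)}$; the kernel of the extension is the required point of the torus. -/
lemma monomialArc_mem_torusArcs {f : ℂ⟦X⟧} (hf0 : f ≠ 0) (hf : PowerSeries.coeff 0 f = 0) :
    monomialArc (weight Λ e he) f ∈ torusArcs Λ := by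
  refine ⟨monomialArc_mem_arcsAtOrigin Λ e he hf, ?_⟩
  let K := FractionRing ℂ⟦X⟧
  have hinj : Function.Injective (algebraMap ℂ⟦X⟧ K) := IsFractionRing.injective _ _
  let y : Kˣ := Units.mk0 (algebraMap ℂ⟦X⟧ K f) ((map_ne_zero_iff _ hinj).mpr hf0)
  let F : AddMonoidAlgebra ℂ M →ₐ[ℂ] K := AddMonoidAlgebra.lift ℂ K M
    ((Units.coeHom K).comp ((zpowersHom Kˣ y).comp
      (AddMonoidHom.toMultiplicative e.toAddMonoidHom)))
  have hF : ∀ u : M, F (AddMonoidAlgebra.single u 1) = algebraMap ℂ⟦X⟧ K f ^ e u := by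
    intro u
    refine (AddMonoidAlgebra.lift_single _ u (1 : ℂ)).trans ?_
    simp [y]
  have hcomp : F.comp (AddMonoidAlgebra.mapDomainAlgHom ℂ ℂ Λ.subtype) =
      (IsScalarTower.toAlgHom ℂ ℂ⟦X⟧ K).comp (monomialArc (weight Λ e he) f) := by
    refine AddMonoidAlgebra.algHom_ext (fun u => ?_) (by ext)
    rw [AlgHom.comp_apply, AlgHom.comp_apply, monomialArc_single]
    have : AddMonoidAlgebra.mapDomainAlgHom ℂ ℂ Λ.subtype (AddMonoidAlgebra.single u 1) =
      AddMonoidAlgebra.single (u : M) 1 := AddMonoidAlgebra.mapDomain_single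
    rw [this, hF, ← weight_cast Λ e he, zpow_natCast, map_pow]
    rfl
  refine ⟨⟨RingHom.ker F.toRingHom, RingHom.ker_isPrime _⟩,
    PrimeSpectrum.ext (Ideal.ext fun g => ?_)⟩
  change F (AddMonoidAlgebra.mapDomainAlgHom ℂ ℂ Λ.subtype g) = 0 ↔
    monomialArc (weight Λ e he) f g = 0
  have := congrArg (fun α => α g) hcomp
  simp only [AlgHom.comp_apply] at this
  rw [this]
  exact map_eq_zero_iff _ hinj

lemma apply_monom_ne_zero_of_mem_torusArcs {h : Arc (CoordRing Λ)} (hh : h ∈ torusArcs Λ) (u : Λ) :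
    h (monom u) ≠ 0 := by
  intro h0
  obtain ⟨Q, hQ⟩ := hh.2
  have h1 : monom u ∈ (PrimeSpectrum.comap h.toRingHom ⊥).asIdeal := h0
  rw [← hQ] at h1
  have h2 : AddMonoidAlgebra.mapDomainRingHom ℂ Λ.subtype (monom u) ∈ Q.asIdeal := h1
  have h3 : AddMonoidAlgebra.mapDomainRingHom ℂ Λ.subtype (monom u) =
    AddMonoidAlgebra.single (u : M) 1 := AddMonoidAlgebra.mapDomain_single
  rw [h3] at h2
  refine Q.2.ne_top (Ideal.eq_top_of_isUnit_mem _ h2 ?_)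
  refine IsUnit.of_mul_eq_one (AddMonoidAlgebra.single (-(u : M)) 1) ?_
  rw [AddMonoidAlgebra.single_mul_single, add_neg_cancel, one_mul]
  rfl

/-- If $u$ and $v$ have weights differing by one, $f$ must be $h(X^u)/h(X^v)$. This quotient is a
power series because a positive power of it is one, namely the value of $h$ at the monomial of any
$u_0 \ne 0$. -/
lemma exists_eq_monomialArc (hgen : AddSubgroup.closure (Λ : Set M) = ⊤) {u₀ : Λ} (hu₀ : u₀ ≠ 0)
    {h : Arc (CoordRing Λ)} (hh : h ∈ torusArcs Λ) :
    ∃ f : ℂ⟦X⟧, f ≠ 0 ∧ PowerSeries.coeff 0 f = 0 ∧ h = monomialArc (weight Λ e he) f := by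
  obtain ⟨u, v, huv⟩ := exists_weight_eq_add_one Λ e he hgen
  have hne := apply_monom_ne_zero_of_mem_torusArcs Λ hh
  have hadd : ∀ a b : Λ, h (monom (a + b)) = h (monom a) * h (monom b) := fun a b => by
    rw [← map_mul, monom, monom, monom, AddMonoidAlgebra.single_mul_single, one_mul]
  have hsmul : ∀ (n : ℕ) (a : Λ), h (monom (n • a)) = h (monom a) ^ n := fun n a => by
    rw [← map_pow, monom, monom, AddMonoidAlgebra.single_pow, one_pow]
  have key : ∀ w : Λ, h (monom u) ^ weight Λ e he w =
      h (monom w) * h (monom v) ^ weight Λ e he w := by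
    intro w
    rw [← hsmul, ← hsmul, ← hadd]
    congr 2
    apply weight_injective Λ e he
    rw [map_add, map_nsmul, map_nsmul, huv, smul_eq_mul, smul_eq_mul]
    ring
  have hdvd : h (monom v) ∣ h (monom u) := by
    -- Normality of $\mathbf C[[t]]$ enters here: divisibility of powers implies divisibility.
    rw [← UniqueFactorizationMonoid.pow_dvd_pow_iff_dvd (weight_ne_zero Λ e he hu₀), key u₀]
    exact dvd_mul_left _ _
  obtain ⟨f, hf⟩ := hdvd
  have hf' : ∀ w : Λ, h (monom w) = f ^ weight Λ e he w := by
    intro w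
    have := key w
    rw [hf, mul_pow, mul_comm] at this
    exact (mul_right_cancel₀ (pow_ne_zero _ (hne v)) this).symm
  refine ⟨f, ?_, ?_, eq_monomialArc _ _ _ hf'⟩
  · rintro rfl
    exact hne u (by rw [hf, mul_zero])
  · have h0 := coeff_zero_of_mem_arcsAtOrigin Λ hh.1 hu₀
    rw [hf', PowerSeries.coeff_zero_eq_constantCoeff_apply, map_pow] at h0
    rw [PowerSeries.coeff_zero_eq_constantCoeff_apply]
    exact eq_zero_of_pow_eq_zero h0

lemma torusArcs_eq (hgen : AddSubgroup.closure (Λ : Set M) = ⊤) {u₀ : Λ} (hu₀ : u₀ ≠ 0) :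
    torusArcs Λ = {h | ∃ f : ℂ⟦X⟧, f ≠ 0 ∧ PowerSeries.coeff 0 f = 0 ∧
      h = monomialArc (weight Λ e he) f} := by
  ext h
  refine ⟨exists_eq_monomialArc Λ e he hgen hu₀, ?_⟩
  rintro ⟨f, hf0, hf, rfl⟩
  exact monomialArc_mem_torusArcs Λ e he hf0 hf

open scoped TensorProduct

lemma realCoord_mem_dualCone (Λ : AddSubmonoid M) (e : M ≃+ ℤ) (he : ∀ u ∈ Λ, 0 ≤ e u) :
    (realCoord e).toLinearMap ∈ dualCone Λ := by
  rw [dualCone, realCone, PointedCone.dual_hull, PointedCone.mem_dual]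
  rintro _ ⟨u, hu, rfl⟩
  change 0 ≤ realCoord e (1 ⊗ₜ[ℤ] u)
  rw [realCoord_tmul]
  exact_mod_cast he u hu

/-- The faces of `σ` other than `0` all give the constant arc at the origin. -/
lemma iUnion_jet_faceArcs {u₀ : Λ} (hu₀ : u₀ ≠ 0) (s : ℕ) :
    ⋃ θ ∈ {θ | PointedCone.IsFaceOf θ (dualCone Λ) ∧ θ ≠ ⊥}, jet s '' faceArcs Λ θ =
      {jet s (monomialArc (weight Λ e he) 0)} := by
  refine Set.Subset.antisymm ?_ ?_
  · refine Set.iUnion₂_subset ?_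
    rintro θ ⟨-, hθ⟩ _ ⟨h, ⟨hh, hh'⟩, rfl⟩
    obtain ⟨ν, hν, hν0⟩ := Submodule.exists_mem_ne_zero_of_ne_bot hθ
    refine congrArg (jet s) (eq_monomialArc _ _ _ fun u => ?_)
    by_cases hu : u = 0
    · subst hu
      rw [map_zero, pow_zero]
      exact map_one h
    · rw [zero_pow (weight_ne_zero Λ e he hu)]
      -- A form $\nu \in \theta$ vanishing on a nonzero $u$ vanishes on the whole line, contrary to
      -- its choice.
      refine hh' u fun hz => hν0 (LinearMap.ext fun x => ?_)
      have hu' : (u : M) ≠ 0 := fun h => hu (Subtype.ext h)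
      rw [eq_smul_tmul e hu' x, map_smul, hz ν hν, smul_zero, LinearMap.zero_apply]
  · rintro _ rfl
    refine Set.mem_biUnion (x := dualCone Λ) ⟨PointedCone.IsFaceOf.refl _, fun hbot => ?_⟩
      ⟨_, ⟨monomialArc_mem_arcsAtOrigin Λ e he (map_zero _), fun u hu => ?_⟩, rfl⟩
    · have h := realCoord_mem_dualCone Λ e he
      rw [hbot, Submodule.mem_bot] at h
      have h1 := LinearMap.congr_fun h (1 ⊗ₜ[ℤ] (u₀ : M))
      have h2 : realCoord e (1 ⊗ₜ[ℤ] (u₀ : M)) = 0 := h1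
      rw [realCoord_tmul, Int.cast_eq_zero, ← weight_cast Λ e he] at h2
      exact weight_ne_zero Λ e he hu₀ (by exact_mod_cast h2)
    · have hu0 : u ≠ 0 := by
        rintro rfl
        exact hu fun ν _ => by simp
      rw [monomialArc_single, zero_pow (weight_ne_zero Λ e he hu0)]

end Arcs

/-! ### Comparison of jets of monomial arcs -/

section Comparison

variable {P : Type} [AddCommMonoid P] (δ : P →+ ℕ)

lemma exists_eq_C_mul_X_pow_mul {f : ℂ⟦X⟧} (hf : f ≠ 0) :
    ∃ (n : ℕ) (c : ℂ) (v : ℂ⟦X⟧), c ≠ 0 ∧ PowerSeries.coeff 0 v = 1 ∧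
      f = PowerSeries.C c * PowerSeries.X ^ n * v := by
  have hc : PowerSeries.constantCoeff f.divXPowOrder ≠ 0 := fun h =>
    hf (PowerSeries.constantCoeff_divXPowOrder_eq_zero_iff.mp h)
  refine ⟨f.order.toNat, PowerSeries.constantCoeff f.divXPowOrder,
    PowerSeries.C (PowerSeries.constantCoeff f.divXPowOrder)⁻¹ * f.divXPowOrder, hc, ?_, ?_⟩
  · rw [PowerSeries.coeff_C_mul, PowerSeries.coeff_zero_eq_constantCoeff_apply, inv_mul_cancel₀ hc]
  · rw [mul_mul_mul_comm, ← map_mul, mul_inv_cancel₀ hc, map_one, one_mul,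
      PowerSeries.X_pow_order_mul_divXPowOrder]

lemma coeff_zero_C_mul_X_pow_mul {n : ℕ} (hn : n ≠ 0) (c : ℂ) (v : ℂ⟦X⟧) :
    PowerSeries.coeff 0 (PowerSeries.C c * PowerSeries.X ^ n * v) = 0 := by
  rw [PowerSeries.coeff_zero_eq_constantCoeff_apply]
  simp [hn]

lemma C_mul_X_pow_mul_ne_zero {c : ℂ} (hc : c ≠ 0) (n : ℕ) {v : ℂ⟦X⟧}
    (hv : PowerSeries.coeff 0 v = 1) : PowerSeries.C c * PowerSeries.X ^ n * v ≠ 0 := by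
  intro h
  have := congrArg (PowerSeries.coeff n) h
  rw [← pow_one (_ * v), coeff_C_mul_X_pow_mul_pow, mul_one, if_pos le_rfl, pow_one, pow_one,
    Nat.sub_self, hv, mul_one, map_zero] at this
  exact hc this

lemma coeff_leading_ne_zero {c : ℂ} (hc : c ≠ 0) (n m : ℕ) {v : ℂ⟦X⟧}
    (hv : PowerSeries.coeff 0 v = 1) :
    PowerSeries.coeff (n * m) ((PowerSeries.C c * PowerSeries.X ^ n * v) ^ m) ≠ 0 := by
  rw [coeff_C_mul_X_pow_mul_pow, if_pos le_rfl, Nat.sub_self,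
    PowerSeries.coeff_zero_eq_constantCoeff_apply, map_pow,
    ← PowerSeries.coeff_zero_eq_constantCoeff_apply, hv, one_pow, mul_one]
  exact pow_ne_zero _ hc

lemma jet_monomialArc_eq_jet_zero {u₀ : P} (hmin : ∀ u, δ u ≠ 0 → δ u₀ ≤ δ u) {n s : ℕ}
    (h : s < n * δ u₀) (c : ℂ) (v : ℂ⟦X⟧) :
    jet s (monomialArc δ (PowerSeries.C c * PowerSeries.X ^ n * v)) = jet s (monomialArc δ 0) := by
  rw [jet_eq_jet_iff_single]
  intro u j hj
  rw [monomialArc_single, monomialArc_single]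
  by_cases hu : δ u = 0
  · rw [hu, pow_zero, pow_zero]
  · have := Nat.mul_le_mul_left n (hmin u hu)
    rw [zero_pow hu, coeff_C_mul_X_pow_mul_pow, if_neg (by omega), map_zero]

lemma jet_monomialArc_ne_jet_zero {u₀ : P} (hu₀ : δ u₀ ≠ 0) {n s : ℕ} (h : n * δ u₀ ≤ s) {c : ℂ}
    (hc : c ≠ 0) {v : ℂ⟦X⟧} (hv : PowerSeries.coeff 0 v = 1) :
    jet s (monomialArc δ (PowerSeries.C c * PowerSeries.X ^ n * v)) ≠ jet s (monomialArc δ 0) := by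
  intro heq
  have := (jet_eq_jet_iff_single s _ _).mp heq u₀ (n * δ u₀) h
  rw [monomialArc_single, monomialArc_single, zero_pow hu₀, map_zero] at this
  exact coeff_leading_ne_zero hc n (δ u₀) hv this

/-- The coefficient of $t^{n\delta(u_0)}$ in the image of $X^{u_0}$ is nonzero on the left and would
vanish on the right if $n' > n$. Applied in both directions this recovers $n$ from the jet, which
separates the strata. -/
lemma le_of_jet_monomialArc_eq {u₀ : P} (hu₀ : δ u₀ ≠ 0) {n n' s : ℕ} (h : n * δ u₀ ≤ s)
    {c c' : ℂ} (hc : c ≠ 0) {v v' : ℂ⟦X⟧} (hv : PowerSeries.coeff 0 v = 1)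
    (heq : jet s (monomialArc δ (PowerSeries.C c * PowerSeries.X ^ n * v)) =
      jet s (monomialArc δ (PowerSeries.C c' * PowerSeries.X ^ n' * v'))) : n' ≤ n := by
  have := (jet_eq_jet_iff_single s _ _).mp heq u₀ (n * δ u₀) h
  rw [monomialArc_single, monomialArc_single] at this
  by_contra hlt
  rw [coeff_C_mul_X_pow_mul_pow c', if_neg] at this
  · exact coeff_leading_ne_zero hc n (δ u₀) hv this
  · exact not_le.mpr (Nat.mul_lt_mul_of_pos_right (not_le.mp hlt) (Nat.pos_of_ne_zero hu₀))

end Comparison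

/-! ### The auxiliary Poincaré series -/

section Series

variable {M : Type} [AddCommGroup M] (Λ : AddSubmonoid M) (e : M ≃+ ℤ) (he : ∀ u ∈ Λ, 0 ≤ e u)

theorem hasClass_auxiliaryJets (hgen : AddSubgroup.closure (Λ : Set M) = ⊤) {u₀ : Λ}
    (hu₀ : u₀ ≠ 0) (hmin : ∀ u, weight Λ e he u ≠ 0 → weight Λ e he u₀ ≤ weight Λ e he u) (s : ℕ) :
    HasClass (auxiliaryJets Λ s) (∑ n ∈ Finset.Icc 1 (s / weight Λ e he u₀),
      (lefschetz - 1) * lefschetz ^ (s - n * weight Λ e he u₀)) := by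
  have hδ := weight_ne_zero Λ e he hu₀
  have hle : ∀ i : Fin (s / weight Λ e he u₀), (i + 1 : ℕ) * weight Λ e he u₀ ≤ s := fun i =>
    (Nat.le_div_iff_mul_le (Nat.pos_of_ne_zero hδ)).mp i.2
  -- The index `i` stands for the order $n = i + 1$, since order zero would not have its origin at
  -- $0$.
  choose A f himm hrange hclass using fun i : Fin (s / weight Λ e he u₀) =>
    exists_stratum (weight Λ e he) u₀ hδ hmin (i + 1) s (hle i)
  refine ⟨s / weight Λ e he u₀, A, f, ⟨himm, ?_, ?_⟩, ?_⟩
  · intro i j hij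
    rw [hrange, hrange, Set.disjoint_left]
    rintro _ ⟨c, v, hc, hv, rfl⟩ ⟨c', v', hc', hv', heq⟩
    have h1 := le_of_jet_monomialArc_eq (weight Λ e he) hδ (hle i) hc hv heq
    have h2 := le_of_jet_monomialArc_eq (weight Λ e he) hδ (hle j) hc' hv' heq.symm
    exact hij (Fin.ext (by omega))
  · simp_rw [hrange]
    rw [auxiliaryJets, torusArcs_eq Λ e he hgen hu₀, iUnion_jet_faceArcs Λ e he hu₀]
    ext q
    rw [Set.mem_iUnion]
    constructor
    · rintro ⟨i, c, v, hc, hv, rfl⟩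
      exact ⟨⟨_, ⟨_, C_mul_X_pow_mul_ne_zero hc _ hv,
        coeff_zero_C_mul_X_pow_mul (Nat.succ_ne_zero _) c v, rfl⟩, rfl⟩,
        jet_monomialArc_ne_jet_zero (weight Λ e he) hδ (hle i) hc hv⟩
    · rintro ⟨⟨_, ⟨f, hf0, hf, rfl⟩, rfl⟩, hq⟩
      obtain ⟨n, c, v, hc, hv, rfl⟩ := exists_eq_C_mul_X_pow_mul hf0
      have hn : n ≠ 0 := by
        rintro rfl
        rw [pow_zero, mul_one, PowerSeries.coeff_C_mul, hv, mul_one] at hf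
        exact hc hf
      have hns : n * weight Λ e he u₀ ≤ s := by
        by_contra hlt
        exact hq (jet_monomialArc_eq_jet_zero (weight Λ e he) hmin (not_le.mp hlt) c v)
      have := (Nat.le_div_iff_mul_le (Nat.pos_of_ne_zero hδ)).mpr hns
      refine ⟨⟨n - 1, by omega⟩, c, v, hc, hv, ?_⟩
      rw [Nat.sub_add_cancel (Nat.pos_of_ne_zero hn)]
  · rw [Finset.sum_congr rfl fun i _ => hclass i,
      Fin.sum_univ_eq_sum_range (fun i => (lefschetz - 1) *
        lefschetz ^ (s - (i + 1) * weight Λ e he u₀)), Finset.range_eq_Ico,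
      Finset.sum_Ico_add' (fun n => (lefschetz - 1) * lefschetz ^ (s - n * weight Λ e he u₀))]
    rfl

end Series

end MotivicToric

end
-- The formula for the auxiliary Poincaré series
open MotivicToric in
theorem proposition4p4 {M : Type} [AddCommGroup M] [Module.Free ℤ M] [Module.Finite ℤ M]
    (hrank : Module.finrank ℤ M = 1)
    (Λ : AddSubmonoid M) (hfg : Λ.FG) (hgen : AddSubgroup.closure (Λ : Set M) = ⊤)
    (hconvex : (realCone Λ : ConvexCone ℝ (TensorProduct ℤ ℝ M)).Salient)
    (m : ℕ) (hm : HasMultiplicity (originIdeal Λ) m) :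
    (∀ s : ℕ, IsConstructibleSet (auxiliaryJets Λ s)) ∧
    auxiliarySeries Λ =
      PowerSeries.C (lefschetz - 1) * PowerSeries.X ^ m *
        PowerSeries.invOfUnit (1 - PowerSeries.C lefschetz * PowerSeries.X) 1 *
        PowerSeries.invOfUnit (1 - PowerSeries.X ^ m) 1 := by
  obtain ⟨e, he⟩ := exists_coord hrank Λ hconvex
  obtain ⟨u, v, huv⟩ := exists_weight_eq_add_one Λ e he hgen
  obtain ⟨c, hc⟩ := exists_conductor (weight Λ e he) huv
  obtain ⟨u₀, hu₀, hmin⟩ : ∃ u₀, weight Λ e he u₀ ≠ 0 ∧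
      ∀ u, weight Λ e he u ≠ 0 → weight Λ e he u₀ ≤ weight Λ e he u := by
    classical
    have hex : ∃ n, ∃ w, weight Λ e he w = n ∧ n ≠ 0 := ⟨_, u, rfl, by omega⟩
    obtain ⟨w, hw, hw0⟩ := Nat.find_spec hex
    exact ⟨w, hw ▸ hw0, fun x hx => hw ▸ Nat.find_min' hex ⟨x, rfl, hx⟩⟩
  have hm' : m = weight Λ e he u₀ :=
    HasMultiplicity.eq_of_monomialIdeal (weight Λ e he) (weight_injective Λ e he) hu₀ hmin hc hm
  have hu₀' : u₀ ≠ 0 := by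
    rintro rfl
    exact hu₀ (map_zero _)
  have hclass := hasClass_auxiliaryJets Λ e he hgen hu₀' hmin
  refine ⟨fun s => ⟨_, hclass s⟩, ?_⟩
  rw [hm', ← mk_sum_Icc_eq lefschetz (Nat.pos_of_ne_zero hu₀)]
  exact PowerSeries.ext fun s => by
    rw [auxiliarySeries, PowerSeries.coeff_mk, PowerSeries.coeff_mk,
      (hclass s).constructibleClass_eq]
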